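/- **Definitions.** An ultragraph $\mathcal G=(\mathcal G^0,\mathcal G^1,r,s)$ consists of countable sets $\mathcal G^0$ (vertices) and $\mathcal G^1$ (edges), a map $s:\mathcal G^1\to\mathcal G^0$ and a map $r:\mathcal G^1\to P(\mathcal G^0)$. Let $\mathcal E$ be the smallest collection of subsets of $\mathcal G^0$ that contains $\emptyset$, all $\{v\}$ with $v\in\mathcal G^0$ and all $r(e)$ with $e\in\mathcal G^1$, and is closed under finite unions and nonempty finite intersections. Let $\mathrm{Reg}(\mathcal G)=\{v: 0<|s^{-1}(v)|<\infty\}$. A relative ultragraph is a pair $(\mathcal G,X)$ with $X\subseteq \mathrm{Reg}(\mathcal G)$. Its $C^*$-algebra $C^*(\mathcal G,X)$ is the universal $C^*$-algebra generated by partial isometries $\{s_e:e\in\mathcal G^1\}$ with mutually orthogonal ranges and projections $\{p_A:A\in\mathcal E\}$ such that 1. $p_\emptyset=0$, $p_Ap_B=p_{A\cap B}$ and $p_{A\cup B}=p_A+p_B-p_{A\cap B}$ for all $A,B\in\mathcal E$; 2. $s_e^*s_e=p_{r(e)}$ for all $e\in\mathcal G^1$; 3. $s_es_e^*\le p_{s(e)}$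 for all $e\in\mathcal G^1$; 4. $p_v=\sum_{s(e)=v}s_es_e^*$ for all $v\in X$ (where $p_v:=p_{\{v\}}$). The ultragraph $C^*$-algebra is $C^*(\mathcal G)=C^*(\mathcal G,\mathrm{Reg}(\mathcal G))$. Let $(\mathcal G,X)$ be a relative ultragraph and $Y:=\mathrm{Reg}(\mathcal G)\setminus X$. Let $Y'=\{v':v\in Y\}$ be a disjoint copy of $Y$, and for $A\subseteq\mathcal G^0$ put $(A\cap Y)'=\{v':v\in A\cap Y\}$. The ultragraph $\mathcal G_X$ has vertex set $\mathcal G^0\sqcup Y'$ and edge set $\mathcal G^1\sqcup\{e': e\in\mathcal G^1,\ r(e)\cap Y\ne\emptyset\}$; its source and range maps extend those of $\mathcal G$, and $s(e')=s(e)$, $r(e')=(r(e)\cap Y)'$. Write $\mathcal E_X$ for its collection of vertex sets, and $S_f$, $P_Z$ for the canonical generators of $C^*(\mathcal G_X)$. **Theorem.** Let $(\mathcal G,X)$ be a relative ultragraph such that $r(e)\cap Y$ is finite for every $e\in\mathcal G^1$. Then there is a unique $*$-homomorphism $\phi:C^*(\mathcal G,X)\to C^*(\mathcal G_X)$ with $$\phi(p_B)=P_B+P_{(B\cap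 Y)'}\quad(B\in\mathcal E),\qquad \phi(s_e)=\begin{cases}S_e,& r(e)\cap Y=\emptyset,\\ S_e+S_{e'},& r(e)\cap Y\neq\emptyset\end{cases}\quad(e\in\mathcal G^1),$$ and $\phi$ is a $*$-isomorphism. Every $Z\in\mathcal E_X$ has the form $Z=A\cup(B\cap Y)'$ with $A,B\in\mathcal E$ (and $A=Z\cap\mathcal G^0$, $B\cap Y=\{v\in Y:v'\in Z\}$ are then clearly determined by $Z$). The inverse of $\phi$ is the unique $*$-homomorphism $\psi:C^*(\mathcal G_X)\to C^*(\mathcal G,X)$ such that, with $q_w:=p_w-\sum_{s(e)=w}s_es_e^*$ for $w\in Y$, $$\psi(P_Z)=p_A-p_{A\cap Y}+\sum_{s(g)\in A\cap Y}s_gs_g^*+\sum_{w\in B\cap Y}q_w\qquad(Z=A\cup(B\cap Y)'\in\mathcal E_X),$$ $$\psi(S_f)=s_f\Big(p_{r(f)}-p_{r(f)\cap Y}+\sum_{s(g)\in r(f)\cap Y}s_gs_g^*\Big)\qquad(f\in\mathcal G^1),$$ $$\psi(S_{e'})=s_e\Big(p_{r(e)\cap Y}-\sum_{s(g)\in r(e)\cap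 Y}s_gs_g^*\Big)\qquad(e\in\mathcal G^1,\ r(e)\cap Y\neq\emptyset),$$ where $g$ ranges over $\mathcal G^1$ and all sums are finite, since $A\cap Y$ is finite for every $A\in\mathcal E$ by the hypothesis. -/

import Mathlib

open scoped ENNReal

universe u

/-- An ultragraph: countable sets of vertices and edges, a source map into vertices and a range map
into sets of vertices. -/
structure Ultragraph where
  Vert : Type u
  Edge : Type u
  countable_vert : Countable Vert
  countable_edge : Countable Edge
  src : Edge → Vert
  ran : Edge → Set Vert

namespace Ultragraph

/-- Membership in the smallest collection of sets of vertices that contains all singletons `{v}`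
and all ranges `r(e)` and is closed under finite unions (so it contains `∅`) and under
intersections of finitely many (at least one) members. -/
inductive MemE (G : Ultragraph.{u}) : Set G.Vert → Prop
  | empty : G.MemE ∅
  | vertex (v : G.Vert) : G.MemE {v}
  | range (e : G.Edge) : G.MemE (G.ran e)
  | union {A B : Set G.Vert} : G.MemE A → G.MemE B → G.MemE (A ∪ B)
  | inter {A B : Set G.Vert} : G.MemE A → G.MemE B → G.MemE (A ∩ B)

/-- The collection `𝓔` of sets of vertices, as a type. -/
def E (G : Ultragraph.{u}) : Type u := {A : Set G.Vert // G.MemE A}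

/-- The vertices that emit at least one and at most finitely many edges. -/
def Reg (G : Ultragraph.{u}) : Set G.Vert :=
  {v | (G.src ⁻¹' {v}).Nonempty ∧ (G.src ⁻¹' {v}).Finite}

/-- A family `{s_e}`, `{p_A}` in a C*-algebra satisfying the defining relations of the relative
ultragraph C*-algebra of `(G, X)`. -/
structure RelFamily (G : Ultragraph.{u}) (X : Set G.Vert) (𝔄 : Type u)
    [NonUnitalCStarAlgebra 𝔄] where
  s : G.Edge → 𝔄
  p : G.E → 𝔄
  /-- each `s_e` is a partial isometry -/
  s_partial : ∀ e, s e * star (s e) * s e = s e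
  /-- the range projections of the `s_e` are mutually orthogonal -/
  s_orth : ∀ e f, e ≠ f → (s e * star (s e)) * (s f * star (s f)) = 0
  /-- each `p_A` is a projection -/
  p_proj : ∀ A, IsStarProjection (p A)
  p_empty : p ⟨∅, .empty⟩ = 0
  p_inter : ∀ A B : G.E, p A * p B = p ⟨A.1 ∩ B.1, A.2.inter B.2⟩
  p_union : ∀ A B : G.E,
    p ⟨A.1 ∪ B.1, A.2.union B.2⟩ = p A + p B - p ⟨A.1 ∩ B.1, A.2.inter B.2⟩
  star_s_mul_s : ∀ e, star (s e) * s e = p ⟨G.ran e, .range e⟩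
  /-- `s_e s_e^* ≤ p_{s(e)}`; for projections `q ≤ p` means `p q = q` -/
  s_le : ∀ e, p ⟨{G.src e}, .vertex _⟩ * (s e * star (s e)) = s e * star (s e)
  /-- the Cuntz–Krieger relation at the vertices of `X` (a finite sum, `X` being a set of regular
  vertices) -/
  ck : ∀ v ∈ X, ∀ h : (G.src ⁻¹' {v}).Finite,
    p ⟨{v}, .vertex v⟩ = ∑ e ∈ h.toFinset, s e * star (s e)

/-- Formal `*`-polynomials (without constant term) with complex coefficients in the symbols `s_e`
and `p_A`. -/
inductive StarPoly (G : Ultragraph.{u}) : Type u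
  | s (e : G.Edge) : StarPoly G
  | p (A : G.E) : StarPoly G
  | zero : StarPoly G
  | add (a b : StarPoly G) : StarPoly G
  | smul (c : ℂ) (a : StarPoly G) : StarPoly G
  | mul (a b : StarPoly G) : StarPoly G
  | adj (a : StarPoly G) : StarPoly G

/-- Evaluation of a formal `*`-polynomial at elements `s_e` and `p_A` of a C*-algebra. -/
def StarPoly.eval {G : Ultragraph.{u}} {𝔄 : Type u} [NonUnitalCStarAlgebra 𝔄]
    (S : G.Edge → 𝔄) (P : G.E → 𝔄) : StarPoly G → 𝔄
  | .s e => S e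
  | .p A => P A
  | .zero => 0
  | .add a b => a.eval S P + b.eval S P
  | .smul c a => c • a.eval S P
  | .mul a b => a.eval S P * b.eval S P
  | .adj a => star (a.eval S P)

/-- The set of all seminorms `a ↦ ‖a(s, p)‖` on formal `*`-polynomials that arise from families
`(s, p)` satisfying the relations, in arbitrary C*-algebras. -/
def RelSeminorm (G : Ultragraph.{u}) (X : Set G.Vert) : Type u :=
  {N : StarPoly G → ℝ // ∃ (𝔄 : Type u) (_ : NonUnitalCStarAlgebra 𝔄) (F : RelFamily G X 𝔄),
    ∀ a, N a = ‖a.eval F.s F.p‖}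

section Construction

variable {G : Ultragraph.{u}} {X : Set G.Vert}

/-- A C*-algebra with a family that realises the seminorm `N`. -/
def RelSeminorm.Carrier (N : RelSeminorm G X) : Type u := N.2.choose

noncomputable instance (N : RelSeminorm G X) : NonUnitalCStarAlgebra N.Carrier :=
  N.2.choose_spec.choose

/-- A family that realises the seminorm `N`. -/
noncomputable def RelSeminorm.fam (N : RelSeminorm G X) : RelFamily G X N.Carrier :=
  N.2.choose_spec.choose_spec.choose

theorem RelSeminorm.fam_spec (N : RelSeminorm G X) (a : StarPoly G) :
    N.1 a = ‖a.eval N.fam.s N.fam.p‖ :=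
  N.2.choose_spec.choose_spec.choose_spec a

theorem RelFamily.norm_p_le {𝔄 : Type u} [NonUnitalCStarAlgebra 𝔄] (F : RelFamily G X 𝔄)
    (A : G.E) : ‖F.p A‖ ≤ 1 := by
  have h := F.p_proj A
  have h1 : ‖F.p A‖ = ‖F.p A‖ * ‖F.p A‖ := by
    conv_lhs => rw [← h.isIdempotentElem.eq]
    conv_lhs => enter [1, 1]; rw [← h.isSelfAdjoint.star_eq]
    exact CStarRing.norm_star_mul_self
  by_contra hc
  nlinarith

theorem RelFamily.norm_s_le {𝔄 : Type u} [NonUnitalCStarAlgebra 𝔄] (F : RelFamily G X 𝔄)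
    (e : G.Edge) : ‖F.s e‖ ≤ 1 := by
  have h1 : ‖star (F.s e) * F.s e‖ = ‖F.s e‖ * ‖F.s e‖ := CStarRing.norm_star_mul_self
  rw [F.star_s_mul_s] at h1
  have := F.norm_p_le ⟨G.ran e, .range e⟩
  by_contra hc
  nlinarith

variable (G X)

/-- The C*-algebra of bounded sections, i.e. the `ℓ^∞`-product of the C*-algebras that realise the
seminorms. -/
abbrev RelProd : Type u := lp (fun N : RelSeminorm G X => N.Carrier) ∞

/-- The `s_e` of all realising families, as one element of the product. -/
noncomputable def prodS (e : G.Edge) : RelProd G X :=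
  ⟨fun N => N.fam.s e, memℓp_infty ⟨1, by rintro _ ⟨N, rfl⟩; exact N.fam.norm_s_le e⟩⟩

/-- The `p_A` of all realising families, as one element of the product. -/
noncomputable def prodP (A : G.E) : RelProd G X :=
  ⟨fun N => N.fam.p A, memℓp_infty ⟨1, by rintro _ ⟨N, rfl⟩; exact N.fam.norm_p_le A⟩⟩

/-- The closed `*`-subalgebra of the product that is generated by the `s_e` and the `p_A`. The norm
of a `*`-polynomial in the generators is the supremum of its norms over all families that satisfy
the relations, so this is the completion of the `*`-algebra of `*`-polynomials in the universal
C*-seminorm. -/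
noncomputable def relSubalgebra : NonUnitalStarSubalgebra ℂ (RelProd G X) :=
  (NonUnitalStarAlgebra.adjoin ℂ (Set.range (prodS G X) ∪ Set.range (prodP G X))).topologicalClosure

/-- The relative ultragraph C*-algebra `C*(G, X)`: the universal C*-algebra generated by a
family satisfying the relations of `RelFamily G X`. -/
def RelCStar : Type u := relSubalgebra G X

noncomputable instance : NonUnitalCStarAlgebra (RelCStar G X) :=
  NonUnitalStarSubalgebra.nonUnitalCStarAlgebra (relSubalgebra G X)
    (h_closed := NonUnitalStarSubalgebra.isClosed_topologicalClosure _)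

namespace RelCStar

/-- The canonical generators `s_e` of `C*(G, X)`. -/
noncomputable def s (e : G.Edge) : RelCStar G X :=
  ⟨prodS G X e, NonUnitalStarSubalgebra.le_topologicalClosure _
    (NonUnitalStarAlgebra.subset_adjoin ℂ _ (Or.inl ⟨e, rfl⟩))⟩

/-- The canonical generators `p_A` of `C*(G, X)`. -/
noncomputable def p (A : G.E) : RelCStar G X :=
  ⟨prodP G X A, NonUnitalStarSubalgebra.le_topologicalClosure _
    (NonUnitalStarAlgebra.subset_adjoin ℂ _ (Or.inr ⟨A, rfl⟩))⟩

end RelCStar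

end Construction

end Ultragraph

namespace Ultragraph

section Universal

variable {G : Ultragraph.{u}} {X : Set G.Vert}

theorem relProd_ext {x y : RelProd G X} (h : ∀ N, x.1 N = y.1 N) : x = y :=
  Subtype.ext (funext h)

theorem relProd_sum_apply {ι : Type*} (t : Finset ι) (f : ι → RelProd G X)
    (N : RelSeminorm G X) : (∑ i ∈ t, f i).1 N = ∑ i ∈ t, (f i).1 N := by
  classical
  induction t using Finset.induction_on with
  | empty => simp
  | insert a t ha ih =>
    rw [Finset.sum_insert ha, Finset.sum_insert ha, ← ih]
    rfl

theorem relCStar_coe_sum {ι : Type*} (t : Finset ι) (f : ι → RelCStar G X) :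
    (∑ i ∈ t, f i).1 = ∑ i ∈ t, (f i).1 := by
  classical
  induction t using Finset.induction_on with
  | empty => simp; rfl
  | insert a t ha ih =>
    rw [Finset.sum_insert ha, Finset.sum_insert ha, ← ih]
    rfl

variable (G X) in
/-- The canonical generators of `C*(G, X)` satisfy the defining relations. -/
noncomputable def RelCStar.family : RelFamily G X (RelCStar G X) where
  s := RelCStar.s G X
  p := RelCStar.p G X
  s_partial e := Subtype.ext <| relProd_ext fun N => N.fam.s_partial e
  s_orth e f h := Subtype.ext <| relProd_ext fun N => N.fam.s_orth e f h
  p_proj A := ⟨Subtype.ext <| relProd_ext fun N => (N.fam.p_proj A).isIdempotentElem,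
    Subtype.ext <| relProd_ext fun N => (N.fam.p_proj A).isSelfAdjoint⟩
  p_empty := Subtype.ext <| relProd_ext fun N => N.fam.p_empty
  p_inter A B := Subtype.ext <| relProd_ext fun N => N.fam.p_inter A B
  p_union A B := Subtype.ext <| relProd_ext fun N => N.fam.p_union A B
  star_s_mul_s e := Subtype.ext <| relProd_ext fun N => N.fam.star_s_mul_s e
  s_le e := Subtype.ext <| relProd_ext fun N => N.fam.s_le e
  ck v hv h := Subtype.ext <| relProd_ext fun N => by
    rw [relCStar_coe_sum, relProd_sum_apply]
    exact N.fam.ck v hv h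

theorem eval_mem_adjoin {𝔄 : Type u} [NonUnitalCStarAlgebra 𝔄]
    (S : G.Edge → 𝔄) (P : G.E → 𝔄) (a : StarPoly G) :
    a.eval S P ∈ NonUnitalStarAlgebra.adjoin ℂ (Set.range S ∪ Set.range P) := by
  induction a with
  | s e => exact NonUnitalStarAlgebra.subset_adjoin ℂ _ (Or.inl ⟨e, rfl⟩)
  | p A => exact NonUnitalStarAlgebra.subset_adjoin ℂ _ (Or.inr ⟨A, rfl⟩)
  | zero => exact zero_mem _
  | add a b iha ihb => exact add_mem iha ihb
  | smul c a ih => exact SMulMemClass.smul_mem c ih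
  | mul a b iha ihb => exact mul_mem iha ihb
  | adj a ih => exact star_mem ih

theorem exists_eval_of_mem_adjoin {𝔄 : Type u} [NonUnitalCStarAlgebra 𝔄]
    (S : G.Edge → 𝔄) (P : G.E → 𝔄) {x : 𝔄}
    (hx : x ∈ NonUnitalStarAlgebra.adjoin ℂ (Set.range S ∪ Set.range P)) :
    ∃ a : StarPoly G, a.eval S P = x := by
  induction hx using NonUnitalStarAlgebra.adjoin_induction with
  | mem x hx =>
    rcases hx with ⟨e, rfl⟩ | ⟨A, rfl⟩
    · exact ⟨.s e, rfl⟩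
    · exact ⟨.p A, rfl⟩
  | zero => exact ⟨.zero, rfl⟩
  | add x y _ _ hx hy =>
    obtain ⟨a, rfl⟩ := hx
    obtain ⟨b, rfl⟩ := hy
    exact ⟨.add a b, rfl⟩
  | smul c x _ hx =>
    obtain ⟨a, rfl⟩ := hx
    exact ⟨.smul c a, rfl⟩
  | mul x y _ _ hx hy =>
    obtain ⟨a, rfl⟩ := hx
    obtain ⟨b, rfl⟩ := hy
    exact ⟨.mul a b, rfl⟩
  | star x _ hx =>
    obtain ⟨a, rfl⟩ := hx
    exact ⟨.adj a, rfl⟩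

theorem eval_map {𝔄 𝔅 : Type u} [NonUnitalCStarAlgebra 𝔄] [NonUnitalCStarAlgebra 𝔅]
    (π : 𝔄 →⋆ₙₐ[ℂ] 𝔅) (S : G.Edge → 𝔄) (P : G.E → 𝔄) (a : StarPoly G) :
    π (a.eval S P) = a.eval (fun e => π (S e)) (fun A => π (P A)) := by
  induction a with
  | s e => rfl
  | p A => rfl
  | zero => exact map_zero π
  | add a b iha ihb => simp only [StarPoly.eval, map_add, iha, ihb]
  | smul c a ih => simp only [StarPoly.eval, map_smul, ih]
  | mul a b iha ihb => simp only [StarPoly.eval, map_mul, iha, ihb]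
  | adj a ih => simp only [StarPoly.eval, map_star, ih]

theorem eval_prod_apply (a : StarPoly G) (N : RelSeminorm G X) :
    (a.eval (prodS G X) (prodP G X)).1 N = a.eval N.fam.s N.fam.p := by
  induction a with
  | s e => rfl
  | p A => rfl
  | zero => rfl
  | add a b iha ihb => simp only [StarPoly.eval, ← iha, ← ihb]; rfl
  | smul c a ih => simp only [StarPoly.eval, ← ih]; rfl
  | mul a b iha ihb => simp only [StarPoly.eval, ← iha, ← ihb]; rfl
  | adj a ih => simp only [StarPoly.eval, ← ih]; rfl

theorem norm_eval_le {𝔄 : Type u} [NonUnitalCStarAlgebra 𝔄] (F : RelFamily G X 𝔄)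
    (a : StarPoly G) :
    ‖a.eval F.s F.p‖ ≤ ‖a.eval (prodS G X) (prodP G X)‖ := by
  let N : RelSeminorm G X := ⟨fun a => ‖a.eval F.s F.p‖, 𝔄, inferInstance, F, fun _ => rfl⟩
  have h : ‖a.eval F.s F.p‖ = ‖a.eval N.fam.s N.fam.p‖ := N.fam_spec a
  rw [h, ← eval_prod_apply]
  exact lp.norm_apply_le_norm ENNReal.top_ne_zero _ N

theorem eval_relCStar_coe (a : StarPoly G) :
    (a.eval (RelCStar.s G X) (RelCStar.p G X)).1 = a.eval (prodS G X) (prodP G X) := by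
  induction a with
  | s e => rfl
  | p A => rfl
  | zero => rfl
  | add a b iha ihb => simp only [StarPoly.eval, ← iha, ← ihb]; rfl
  | smul c a ih => simp only [StarPoly.eval, ← ih]; rfl
  | mul a b iha ihb => simp only [StarPoly.eval, ← iha, ← ihb]; rfl
  | adj a ih => simp only [StarPoly.eval, ← ih]; rfl

theorem denseRange_eval :
    DenseRange fun a : StarPoly G => a.eval (RelCStar.s G X) (RelCStar.p G X) := by
  intro x
  rw [Metric.mem_closure_iff]
  intro ε hε
  have hx : x.1 ∈ closure
      (NonUnitalStarAlgebra.adjoin ℂ (Set.range (prodS G X) ∪ Set.range (prodP G X)) :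
        Set (RelProd G X)) := x.2
  obtain ⟨y, hy, hxy⟩ := Metric.mem_closure_iff.1 hx ε hε
  obtain ⟨a, rfl⟩ := exists_eval_of_mem_adjoin _ _ hy
  refine ⟨_, ⟨a, rfl⟩, ?_⟩
  rw [← eval_relCStar_coe] at hxy
  exact hxy

/-- The universal property of `C*(G, X)`. -/
theorem RelCStar.existsUnique_hom {𝔄 : Type u} [NonUnitalCStarAlgebra 𝔄] (F : RelFamily G X 𝔄) :
    ∃! π : RelCStar G X →⋆ₙₐ[ℂ] 𝔄,
      (∀ e, π (RelCStar.s G X e) = F.s e) ∧ ∀ A, π (RelCStar.p G X A) = F.p A := by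
  let S : G.Edge → RelCStar G X × 𝔄 := fun e => (RelCStar.s G X e, F.s e)
  let P : G.E → RelCStar G X × 𝔄 := fun A => (RelCStar.p G X A, F.p A)
  let T : NonUnitalStarSubalgebra ℂ (RelCStar G X × 𝔄) :=
    (NonUnitalStarAlgebra.adjoin ℂ (Set.range S ∪ Set.range P)).topologicalClosure
  have hfst : ∀ a : StarPoly G, (a.eval S P).1 = a.eval (RelCStar.s G X) (RelCStar.p G X) :=
    fun a => eval_map (NonUnitalStarAlgHom.fst ℂ (RelCStar G X) 𝔄) S P a
  have hsnd : ∀ a : StarPoly G, (a.eval S P).2 = a.eval F.s F.p :=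
    fun a => eval_map (NonUnitalStarAlgHom.snd ℂ (RelCStar G X) 𝔄) S P a
  have hle : ∀ x ∈ T, ‖x.2‖ ≤ ‖x.1‖ := by
    intro x hx
    have hcl : IsClosed {x : RelCStar G X × 𝔄 | ‖x.2‖ ≤ ‖x.1‖} :=
      isClosed_le (by fun_prop) (by fun_prop)
    refine closure_minimal ?_ hcl hx
    intro y hy
    obtain ⟨a, rfl⟩ := exists_eval_of_mem_adjoin _ _ hy
    change ‖(a.eval S P).2‖ ≤ ‖(a.eval S P).1‖
    rw [hfst, hsnd]
    calc _ ≤ _ := norm_eval_le F a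
      _ = _ := by rw [← eval_relCStar_coe]; rfl
  have hTc : IsClosed (T : Set (RelCStar G X × 𝔄)) :=
    NonUnitalStarSubalgebra.isClosed_topologicalClosure _
  let f : T →⋆ₙₐ[ℂ] RelCStar G X :=
    (NonUnitalStarAlgHom.fst ℂ (RelCStar G X) 𝔄).comp (NonUnitalStarSubalgebraClass.subtype T)
  let g : T →⋆ₙₐ[ℂ] 𝔄 :=
    (NonUnitalStarAlgHom.snd ℂ (RelCStar G X) 𝔄).comp (NonUnitalStarSubalgebraClass.subtype T)
  have hf : ∀ x, f x = x.1.1 := fun _ => rfl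
  have hiso : Isometry f := by
    refine AddMonoidHomClass.isometry_of_norm f fun x => ?_
    change ‖x.1.1‖ = ‖x.1‖
    rw [Prod.norm_def, max_eq_left (hle x.1 x.2)]
  have hsurj : Function.Surjective f := by
    have : CompleteSpace T := hTc.completeSpace_coe
    have hr : IsClosed (Set.range f) := hiso.isClosedEmbedding.isClosed_range
    intro x
    refine closure_minimal ?_ hr (denseRange_eval x)
    rintro _ ⟨a, rfl⟩
    exact ⟨⟨a.eval S P, NonUnitalStarSubalgebra.le_topologicalClosure _
      (eval_mem_adjoin S P a)⟩, hfst a⟩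
  let Φ : T ≃⋆ₐ[ℂ] RelCStar G X := StarAlgEquiv.ofBijective f ⟨hiso.injective, hsurj⟩
  have key : ∀ (a : StarPoly G), g (Φ.symm (a.eval (RelCStar.s G X) (RelCStar.p G X)))
      = a.eval F.s F.p := by
    intro a
    have : Φ.symm (a.eval (RelCStar.s G X) (RelCStar.p G X)) =
        ⟨a.eval S P, NonUnitalStarSubalgebra.le_topologicalClosure _
          (eval_mem_adjoin S P a)⟩ := by
      rw [← hfst]
      exact Φ.symm_apply_apply
        ⟨a.eval S P, NonUnitalStarSubalgebra.le_topologicalClosure _ (eval_mem_adjoin S P a)⟩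
    rw [this]
    exact hsnd a
  let π : RelCStar G X →⋆ₙₐ[ℂ] 𝔄 := g.comp (Φ.symm : RelCStar G X →⋆ₙₐ[ℂ] T)
  refine ⟨π, ⟨fun e => key (.s e), fun A => key (.p A)⟩, ?_⟩
  rintro ρ ⟨hs, hp⟩
  have hc : ∀ σ : RelCStar G X →⋆ₙₐ[ℂ] 𝔄, Continuous σ := fun σ =>
    AddMonoidHomClass.continuous_of_bound σ 1 fun x => by
      simpa only [one_mul] using NonUnitalStarAlgHom.norm_apply_le σ x
  refine DFunLike.coe_injective (DenseRange.equalizer denseRange_eval (hc ρ) (hc π) ?_)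
  funext a
  have h2 : (fun e => ρ (RelCStar.s G X e)) = F.s := funext hs
  have h3 : (fun A => ρ (RelCStar.p G X A)) = F.p := funext hp
  change ρ _ = π _
  rw [eval_map, h2, h3]
  exact (key a).symm

end Universal

end Ultragraph

namespace Ultragraph

/-- The ultragraph C*-algebra `C*(G)`: the Cuntz–Krieger relation holds at every regular vertex. -/
abbrev CStar (G : Ultragraph.{u}) : Type u := RelCStar G G.Reg

section Extension

variable (G : Ultragraph.{u}) (X : Set G.Vert)

/-- `Y = Reg(G) \ X`. -/
def Y : Set G.Vert := G.Reg \ X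

/-- `(A ∩ Y)'`, the set of the copies `v'` of the vertices `v ∈ A ∩ Y`, in the disjoint union of
the set of vertices and a copy of `Y`. -/
def prime (A : Set G.Vert) : Set (G.Vert ⊕ G.Y X) := {w | ∃ v : G.Y X, v.1 ∈ A ∧ w = Sum.inr v}

/-- The ultragraph `G_X`: it has the vertices `v` of `G` and a copy `v'` of every `v ∈ Y`, and the
edges `e` of `G` and a copy `e'` of every edge `e` with `r(e) ∩ Y ≠ ∅`. The source of `e'` is
`s(e)` and its range is `(r(e) ∩ Y)'`; sources and ranges of the old edges are unchanged. -/
def ext : Ultragraph.{u} where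
  Vert := G.Vert ⊕ G.Y X
  Edge := G.Edge ⊕ {e : G.Edge // (G.ran e ∩ G.Y X).Nonempty}
  countable_vert := by
    have := G.countable_vert
    infer_instance
  countable_edge := by
    have := G.countable_edge
    infer_instance
  src := Sum.elim (fun e => Sum.inl (G.src e)) (fun e => Sum.inl (G.src e.1))
  ran := Sum.elim (fun e => Sum.inl '' G.ran e) (fun e => G.prime X (G.ran e.1))

variable {G X}

theorem memE_inl {A : Set G.Vert} (hA : G.MemE A) :
    (G.ext X).MemE (Sum.inl '' A : Set (G.Vert ⊕ G.Y X)) := by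
  induction hA with
  | empty => rw [Set.image_empty]; exact .empty
  | vertex v => rw [Set.image_singleton]; exact .vertex (G := G.ext X) (Sum.inl v)
  | range e => exact .range (G := G.ext X) (Sum.inl e)
  | union _ _ hA hB => rw [Set.image_union]; exact hA.union hB
  | inter _ _ hA hB => rw [Set.image_inter Sum.inl_injective]; exact hA.inter hB

theorem memE_prime {A : Set G.Vert} (hA : G.MemE A) : (G.ext X).MemE (G.prime X A) := by
  have hempty : ∀ A : Set G.Vert, (∀ v ∈ A, v ∉ G.Y X) → G.prime X A = ∅ := by
    intro A h
    ext w
    simp only [prime, Set.mem_ofPred_eq, Set.mem_empty_iff_false, iff_false]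
    rintro ⟨v, hv, -⟩
    exact h _ hv v.2
  induction hA with
  | empty => rw [hempty _ (by simp)]; exact .empty
  | vertex v =>
    by_cases hv : v ∈ G.Y X
    · have : G.prime X {v} = {Sum.inr ⟨v, hv⟩} := by
        ext w
        simp only [prime, Set.mem_ofPred_eq, Set.mem_singleton_iff]
        constructor
        · rintro ⟨v', rfl, rfl⟩; rfl
        · rintro rfl; exact ⟨⟨v, hv⟩, rfl, rfl⟩
      rw [this]; exact .vertex (G := G.ext X) (Sum.inr ⟨v, hv⟩)
    · rw [hempty _ (by simpa using hv)]; exact .empty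
  | range e =>
    by_cases he : (G.ran e ∩ G.Y X).Nonempty
    · exact .range (G := G.ext X) (Sum.inr ⟨e, he⟩)
    · rw [hempty _ fun v hv hY => he ⟨v, hv, hY⟩]; exact .empty
  | @union A B _ _ hA hB =>
    have : G.prime X (A ∪ B) = G.prime X A ∪ G.prime X B := by
      ext w
      simp only [prime, Set.mem_ofPred_eq, Set.mem_union]
      grind
    rw [this]; exact hA.union hB
  | @inter A B _ _ hA hB =>
    have : G.prime X (A ∩ B) = G.prime X A ∩ G.prime X B := by
      ext w
      simp only [prime, Set.mem_ofPred_eq, Set.mem_inter_iff]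
      constructor
      · rintro ⟨v, hv, rfl⟩; exact ⟨⟨v, hv.1, rfl⟩, ⟨v, hv.2, rfl⟩⟩
      · rintro ⟨⟨v, hv, rfl⟩, ⟨v', hv', h⟩⟩
        obtain rfl := Sum.inr_injective h
        exact ⟨v, ⟨hv, hv'⟩, rfl⟩
    rw [this]; exact hA.inter hB

theorem memE_of_finite {A : Set G.Vert} (hA : A.Finite) : G.MemE A := by
  induction A, hA using Set.Finite.induction_on with
  | empty => exact .empty
  | @insert v A _ _ ih => rw [Set.insert_eq]; exact (MemE.vertex v).union ih

theorem finite_inter_Y (hfin : ∀ e, (G.ran e ∩ G.Y X).Finite) {A : Set G.Vert} (hA : G.MemE A) :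
    (A ∩ G.Y X).Finite := by
  induction hA with
  | empty => simp
  | vertex v => exact (Set.finite_singleton v).inter_of_left _
  | range e => exact hfin e
  | union _ _ hA hB => rw [Set.union_inter_distrib_right]; exact hA.union hB
  | inter _ _ hA _ => exact hA.subset fun v hv => ⟨hv.1.1, hv.2⟩

theorem memE_inter_Y (hfin : ∀ e, (G.ran e ∩ G.Y X).Finite) {A : Set G.Vert} (hA : G.MemE A) :
    G.MemE (A ∩ G.Y X) :=
  memE_of_finite (finite_inter_Y hfin hA)

theorem finite_src_mem (hfin : ∀ e, (G.ran e ∩ G.Y X).Finite) {A : Set G.Vert}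
    (hA : G.MemE A) : {g : G.Edge | G.src g ∈ A ∩ G.Y X}.Finite := by
  have : {g : G.Edge | G.src g ∈ A ∩ G.Y X} = ⋃ v ∈ A ∩ G.Y X, G.src ⁻¹' {v} := by
    ext g; simp
  rw [this]
  exact (finite_inter_Y hfin hA).biUnion fun v hv => hv.2.1.2

/-- The set `(A ∩ Y)'`, as a member of `𝓔_X`. -/
def primeE (X : Set G.Vert) (A : G.E) : (G.ext X).E := ⟨G.prime X A.1, memE_prime A.2⟩

/-- The set `A` of vertices of `G`, as a member of `𝓔_X`. -/
def inlE (X : Set G.Vert) (A : G.E) : (G.ext X).E := ⟨Sum.inl '' A.1, memE_inl A.2⟩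

/-- The set `A ∪ (B ∩ Y)'`, as a member of `𝓔_X`. -/
def unionE (X : Set G.Vert) (A B : G.E) : (G.ext X).E :=
  ⟨(inlE X A).1 ∪ (primeE X B).1, (inlE X A).2.union (primeE X B).2⟩

/-- The range `r(e)`, as a member of `𝓔`. -/
def ranE (e : G.Edge) : G.E := ⟨G.ran e, .range e⟩

/-- The set `A ∩ Y`, as a member of `𝓔`. -/
def interYE (hfin : ∀ e, (G.ran e ∩ G.Y X).Finite) (A : G.E) : G.E :=
  ⟨A.1 ∩ G.Y X, memE_inter_Y hfin A.2⟩

/-- The formulas that define the canonical `*`-homomorphism `φ : C*(G, X) → C*(G_X)` on the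
generators. -/
structure IsPhi (φ : RelCStar G X →⋆ₙₐ[ℂ] CStar (G.ext X)) : Prop where
  /-- `φ(p_B) = P_B + P_{(B ∩ Y)'}` -/
  map_p : ∀ B : G.E, φ (RelCStar.p G X B) =
    RelCStar.p (G.ext X) _ (inlE X B) + RelCStar.p (G.ext X) _ (primeE X B)
  /-- `φ(s_e) = S_e` if `r(e) ∩ Y = ∅` -/
  map_s_of_empty : ∀ e : G.Edge, G.ran e ∩ G.Y X = ∅ →
    φ (RelCStar.s G X e) = RelCStar.s (G.ext X) _ (Sum.inl e)
  /-- `φ(s_e) = S_e + S_{e'}` if `r(e) ∩ Y ≠ ∅` -/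
  map_s_of_nonempty : ∀ (e : G.Edge) (he : (G.ran e ∩ G.Y X).Nonempty),
    φ (RelCStar.s G X e) =
      RelCStar.s (G.ext X) _ (Sum.inl e) + RelCStar.s (G.ext X) _ (Sum.inr ⟨e, he⟩)

/-- `∑ s_g s_g^*` over the (finitely many) edges `g` of `G` with `s(g) ∈ A ∩ Y`. -/
noncomputable def sumSS (hfin : ∀ e, (G.ran e ∩ G.Y X).Finite) (A : G.E) : RelCStar G X :=
  ∑ g ∈ (finite_src_mem hfin A.2).toFinset, RelCStar.s G X g * star (RelCStar.s G X g)

/-- The element `q_w = p_w - ∑_{s(e) = w} s_e s_e^*` for a vertex `w ∈ Y`. -/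
noncomputable def q {w : G.Vert} (hw : w ∈ G.Y X) : RelCStar G X :=
  RelCStar.p G X ⟨{w}, .vertex w⟩ -
    ∑ e ∈ hw.1.2.toFinset, RelCStar.s G X e * star (RelCStar.s G X e)

/-- `∑ q_w` over the (finitely many) vertices `w ∈ B ∩ Y`. -/
noncomputable def sumQ (hfin : ∀ e, (G.ran e ∩ G.Y X).Finite) (B : G.E) : RelCStar G X :=
  ∑ w ∈ (finite_inter_Y hfin B.2).toFinset.attach,
    q ((finite_inter_Y hfin B.2).mem_toFinset.1 w.2).2

/-- The formulas that define the `*`-homomorphism `ψ : C*(G_X) → C*(G, X)` on the generators. -/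
structure IsPsi (hfin : ∀ e, (G.ran e ∩ G.Y X).Finite)
    (ψ : CStar (G.ext X) →⋆ₙₐ[ℂ] RelCStar G X) : Prop where
  /-- Every `Z ∈ 𝓔_X` is of the form `A ∪ (B ∩ Y)'` with `A, B ∈ 𝓔` (where `A` and `B ∩ Y` are
  determined by `Z`), and `ψ(P_Z) = p_A - p_{A ∩ Y} + ∑_{s(g) ∈ A ∩ Y} s_g s_g^* +
  ∑_{w ∈ B ∩ Y} q_w`. -/
  map_P : ∀ Z : (G.ext X).E, ∃ A B : G.E, Z = unionE X A B ∧
    ψ (RelCStar.p (G.ext X) _ Z) =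
      RelCStar.p G X A - RelCStar.p G X (interYE hfin A) + sumSS hfin A + sumQ hfin B
  /-- `ψ(S_f) = s_f (p_{r(f)} - p_{r(f) ∩ Y} + ∑_{s(g) ∈ r(f) ∩ Y} s_g s_g^*)` for an edge `f`
  of `G` -/
  map_S : ∀ f : G.Edge, ψ (RelCStar.s (G.ext X) _ (Sum.inl f)) =
    RelCStar.s G X f *
      (RelCStar.p G X (ranE f) - RelCStar.p G X (interYE hfin (ranE f)) + sumSS hfin (ranE f))
  /-- `ψ(S_{e'}) = s_e (p_{r(e) ∩ Y} - ∑_{s(g) ∈ r(e) ∩ Y} s_g s_g^*)` -/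
  map_S' : ∀ (e : G.Edge) (he : (G.ran e ∩ G.Y X).Nonempty),
    ψ (RelCStar.s (G.ext X) _ (Sum.inr ⟨e, he⟩)) =
      RelCStar.s G X e * (RelCStar.p G X (interYE hfin (ranE e)) - sumSS hfin (ranE e))

end Extension

end Ultragraph

/-!
Both algebras are universal, so the two homomorphisms and their mutual inverseness come from a
bijection between families: in every C*-algebra, families for `(G, X)` correspond to
Cuntz–Krieger families for `G_X`, naturally in the algebra.

In a family `(s, p)` for `(G, X)` the Cuntz–Krieger relation may fail at `y ∈ Y`, and the failure
is measured by the gap projection `q_y = p_y - ∑_{s(e) = y} s_e s_e^*`. The gap projections are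
mutually orthogonal, satisfy `p_A q_y = q_y` or `0` according to whether `y ∈ A`, and are killed by
every edge: `q_y s_e = 0`. As `A ∩ Y` is finite, every `p_A` is the orthogonal sum of its core
`p_A - ∑_{y ∈ A ∩ Y} q_y` and its gap `∑_{y ∈ A ∩ Y} q_y`; the core maps and the gap maps are
orthogonal to each other and both respect unions and intersections. Taking the cores for the old
vertices, `q_y` for the new vertex `y'`, and cutting `s_e` down by the core and by the gap of
`p_{r(e)}`, gives a family for `G_X` (`RelFamily.split`); at a regular vertex `v` the core of `p_v`
is `∑ s_e s_e^*` (`RelFamily.core_vertex`), which is the Cuntz–Krieger relation for `G_X`.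

Conversely `P_B + P_{(B ∩ Y)'}` and `S_e + S_{e'}` form a family for `(G, X)`
(`RelFamily.glue`), since `r(e)` and `(r(e) ∩ Y)'` are disjoint. Its gap projection at `y` is
`P_{y'}` (`RelFamily.glue_gapAt`), by the Cuntz–Krieger relation of `G_X` at `y`. Hence the two
constructions are inverse to each other (`RelFamily.glue_split`, `RelFamily.split_glue`). The
formulas for `φ` and `ψ` say exactly that they send the canonical family to the glued and to the
split one (`isPhi_iff`, `isPsi_iff`).
-/

namespace Ultragraph

variable {G : Ultragraph.{u}} {X : Set G.Vert} {𝔄 𝔅 : Type u} [NonUnitalCStarAlgebra 𝔄]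
  [NonUnitalCStarAlgebra 𝔅]

/-! ### Consequences of the defining relations -/

/-- The singleton `{v}`, as a member of `𝓔`. -/
def vertE (v : G.Vert) : G.E := ⟨{v}, .vertex v⟩

/-- The intersection of two members of `𝓔`. -/
def capE (A B : G.E) : G.E := ⟨A.1 ∩ B.1, A.2.inter B.2⟩

/-- The union of two members of `𝓔`. -/
def cupE (A B : G.E) : G.E := ⟨A.1 ∪ B.1, A.2.union B.2⟩

theorem val_vertE (v : G.Vert) : (vertE v).1 = {v} := rfl

theorem val_capE (A B : G.E) : (capE A B).1 = A.1 ∩ B.1 := rfl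

theorem val_cupE (A B : G.E) : (cupE A B).1 = A.1 ∪ B.1 := rfl

namespace RelFamily

theorem eq_of_s_p {F F' : RelFamily G X 𝔄} (hs : ∀ e, F.s e = F'.s e)
    (hp : ∀ A, F.p A = F'.p A) : F = F' := by
  obtain ⟨s, p⟩ := F
  obtain ⟨s', p'⟩ := F'
  obtain rfl : s = s' := funext hs
  obtain rfl : p = p' := funext hp
  rfl

/-- The image of a family under a `*`-homomorphism. -/
def map (F : RelFamily G X 𝔄) (π : 𝔄 →⋆ₙₐ[ℂ] 𝔅) : RelFamily G X 𝔅 where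
  s e := π (F.s e)
  p A := π (F.p A)
  s_partial e := by simp only [← map_star, ← map_mul, F.s_partial]
  s_orth e f h := by simp only [← map_star, ← map_mul, F.s_orth e f h, map_zero]
  p_proj A := (F.p_proj A).map π
  p_empty := by rw [F.p_empty, map_zero]
  p_inter A B := by rw [← map_mul, F.p_inter]
  p_union A B := by rw [F.p_union, map_sub, map_add]
  star_s_mul_s e := by rw [← map_star, ← map_mul, F.star_s_mul_s]
  s_le e := by simp only [← map_star, ← map_mul, F.s_le]
  ck v hv h := by simp only [F.ck v hv h, map_sum, map_mul, map_star]

variable (F : RelFamily G X 𝔄)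

theorem p_congr {A B : G.E} (h : A.1 = B.1) : F.p A = F.p B :=
  congrArg F.p (Subtype.ext h)

theorem p_eq_zero {A : G.E} (h : A.1 = ∅) : F.p A = 0 :=
  (F.p_congr h).trans F.p_empty

theorem p_mul_p (A B : G.E) : F.p A * F.p B = F.p (capE A B) := F.p_inter A B

theorem p_cupE (A B : G.E) : F.p (cupE A B) = F.p A + F.p B - F.p (capE A B) := F.p_union A B

theorem star_p (A : G.E) : star (F.p A) = F.p A := (F.p_proj A).isSelfAdjoint

theorem p_mul_self (A : G.E) : F.p A * F.p A = F.p A := (F.p_proj A).isIdempotentElem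

theorem p_mul_p_of_disjoint {A B : G.E} (h : Disjoint A.1 B.1) : F.p A * F.p B = 0 := by
  rw [F.p_mul_p]
  exact F.p_eq_zero (A := capE A B) h.inter_eq

theorem p_union_of_disjoint {A B C : G.E} (hC : C.1 = A.1 ∪ B.1) (h : Disjoint A.1 B.1) :
    F.p C = F.p A + F.p B := by
  have h1 : F.p C = F.p (cupE A B) := F.p_congr hC
  rw [h1, F.p_cupE, F.p_eq_zero (A := capE A B) h.inter_eq, sub_zero]

theorem s_mul_p_ran (e : G.Edge) : F.s e * F.p (ranE e) = F.s e := by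
  have h : F.p (ranE e) = star (F.s e) * F.s e := (F.star_s_mul_s e).symm
  rw [h, ← mul_assoc, F.s_partial]

theorem p_ran_mul_star_s (e : G.Edge) : F.p (ranE e) * star (F.s e) = star (F.s e) := by
  rw [← F.star_p, ← star_mul, F.s_mul_p_ran]

theorem star_s_mul_s_of_ne {e f : G.Edge} (h : e ≠ f) : star (F.s e) * F.s f = 0 := by
  have h1 : star (F.s e) = star (F.s e) * (F.s e * star (F.s e)) := by
    conv_lhs => rw [← F.s_partial e]
    simp only [star_mul, star_star, mul_assoc]
  calc star (F.s e) * F.s f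
      = (star (F.s e) * (F.s e * star (F.s e))) * (F.s f * star (F.s f) * F.s f) := by
        rw [← h1, F.s_partial]
    _ = star (F.s e) * ((F.s e * star (F.s e)) * (F.s f * star (F.s f))) * F.s f := by
        simp only [mul_assoc]
    _ = 0 := by rw [F.s_orth e f h, mul_zero, zero_mul]

theorem p_src_mul_s (e : G.Edge) : F.p (vertE (G.src e)) * F.s e = F.s e := by
  have h : F.p (vertE (G.src e)) * (F.s e * star (F.s e)) = F.s e * star (F.s e) := F.s_le e
  conv_lhs => rw [← F.s_partial e]
  rw [← mul_assoc, h, F.s_partial]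

theorem p_mul_s_of_mem {A : G.E} {e : G.Edge} (h : G.src e ∈ A.1) : F.p A * F.s e = F.s e := by
  rw [← F.p_src_mul_s, ← mul_assoc, F.p_mul_p]
  congr 1
  exact F.p_congr (Set.inter_eq_right.2 (Set.singleton_subset_iff.2 h))

theorem p_mul_s_of_notMem {A : G.E} {e : G.Edge} (h : G.src e ∉ A.1) : F.p A * F.s e = 0 := by
  rw [← F.p_src_mul_s, ← mul_assoc, F.p_mul_p_of_disjoint, zero_mul]
  exact Set.disjoint_singleton_right.2 h

/-- For injective `i`, the projection of the finite set `i(T)` is the sum of the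
projections of its points. -/
theorem p_image_finset {ι : Type*} (i : ι → G.Vert) (hi : i.Injective) (T : Finset ι) (A : G.E)
    (hA : A.1 = i '' T) : F.p A = ∑ x ∈ T, F.p (vertE (i x)) := by
  classical
  induction T using Finset.induction_on generalizing A with
  | empty => rw [Finset.sum_empty]; exact F.p_eq_zero (by simpa using hA)
  | insert a T ha ih =>
    rw [Finset.sum_insert ha,
      ← ih ⟨i '' T, memE_of_finite (T.finite_toSet.image i)⟩ rfl]
    refine F.p_union_of_disjoint ?_ ?_
    · rw [hA, Finset.coe_insert, Set.image_insert_eq, Set.insert_eq]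
      rfl
    · refine Set.disjoint_singleton_left.2 ?_
      rintro ⟨b, hb, hab⟩
      exact ha (hi hab ▸ hb)

/-! ### The gap projections -/

/-- The gap projection `q_y = p_y - ∑_{s(e) = y} s_e s_e^*` of a vertex `y ∈ Y`. -/
noncomputable def gapAt (y : G.Y X) : 𝔄 :=
  F.p (vertE y.1) - ∑ e ∈ y.2.1.2.toFinset, F.s e * star (F.s e)

theorem star_gapAt (y : G.Y X) : star (F.gapAt y) = F.gapAt y := by
  simp only [gapAt, star_sub, F.star_p, star_sum, star_mul, star_star]

/-- If `s(e) ≠ y`, both terms of `q_y` kill `s_e`; if `s(e) = y`, then `p_y s_e = s_e` and the sum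
keeps only `s_e s_e^* s_e = s_e`. -/
theorem gapAt_mul_s (y : G.Y X) (e : G.Edge) : F.gapAt y * F.s e = 0 := by
  rw [gapAt, sub_mul, Finset.sum_mul]
  by_cases h : G.src e = y.1
  · rw [F.p_mul_s_of_mem (A := vertE y.1) h, Finset.sum_eq_single_of_mem e (by simpa using h),
      F.s_partial, sub_self]
    intro f _ hf
    rw [mul_assoc, F.star_s_mul_s_of_ne hf, mul_zero]
  · rw [F.p_mul_s_of_notMem (A := vertE y.1) h, Finset.sum_eq_zero, sub_zero]
    intro f hf
    rw [mul_assoc, F.star_s_mul_s_of_ne, mul_zero]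
    rintro rfl
    exact h (by simpa using hf)

theorem p_mul_gapAt_of_mem {A : G.E} {y : G.Y X} (h : y.1 ∈ A.1) :
    F.p A * F.gapAt y = F.gapAt y := by
  rw [gapAt, mul_sub, Finset.mul_sum]
  congr 1
  · rw [F.p_mul_p]
    exact F.p_congr (Set.inter_eq_right.2 (Set.singleton_subset_iff.2 h))
  · refine Finset.sum_congr rfl fun e he => ?_
    have he' : G.src e = y.1 := by simpa using he
    rw [← mul_assoc, F.p_mul_s_of_mem (he' ▸ h)]

theorem p_mul_gapAt_of_notMem {A : G.E} {y : G.Y X} (h : y.1 ∉ A.1) :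
    F.p A * F.gapAt y = 0 := by
  rw [gapAt, mul_sub, Finset.mul_sum, F.p_mul_p_of_disjoint (Set.disjoint_singleton_right.2 h),
    Finset.sum_eq_zero, sub_zero]
  intro e he
  have he' : G.src e = y.1 := by simpa using he
  rw [← mul_assoc, F.p_mul_s_of_notMem (he' ▸ h), zero_mul]

/-- In `q_y q_z` only the term `p_z` of `q_z` survives, as `q_y` kills all edges. -/
theorem gapAt_mul_gapAt (y z : G.Y X) :
    F.gapAt y * F.gapAt z = F.gapAt y * F.p (vertE z.1) := by
  conv_lhs => rw [gapAt.eq_def F z]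
  rw [mul_sub, Finset.mul_sum, Finset.sum_eq_zero, sub_zero]
  intro e _
  rw [← mul_assoc, F.gapAt_mul_s, zero_mul]

theorem gapAt_mul_self (y : G.Y X) : F.gapAt y * F.gapAt y = F.gapAt y := by
  rw [gapAt_mul_gapAt, ← F.star_gapAt, ← F.star_p, ← star_mul,
    F.p_mul_gapAt_of_mem (Set.mem_singleton _)]

theorem gapAt_mul_of_ne {y z : G.Y X} (h : y ≠ z) : F.gapAt y * F.gapAt z = 0 := by
  rw [gapAt_mul_gapAt, ← F.star_gapAt, ← F.star_p, ← star_mul,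
    F.p_mul_gapAt_of_notMem (by simpa [val_vertE] using fun h' => h (Subtype.ext h')), star_zero]

/-- The sum `∑_{y ∈ T} q_y` of the gap projections over a finite set `T ⊆ Y`. -/
noncomputable def gap (T : Finset (G.Y X)) : 𝔄 := ∑ y ∈ T, F.gapAt y

theorem star_gap (T : Finset (G.Y X)) : star (F.gap T) = F.gap T := by
  simp only [gap, star_sum, F.star_gapAt]

theorem gap_mul_s (T : Finset (G.Y X)) (e : G.Edge) : F.gap T * F.s e = 0 := by
  rw [gap, Finset.sum_mul]
  exact Finset.sum_eq_zero fun y _ => F.gapAt_mul_s y e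

open scoped Classical in
theorem gap_mul_gap (T U : Finset (G.Y X)) : F.gap T * F.gap U = F.gap (T ∩ U) := by
  simp only [gap, Finset.sum_mul_sum]
  rw [← Finset.filter_mem_eq_inter, Finset.sum_filter]
  refine Finset.sum_congr rfl fun y _ => ?_
  split_ifs with h
  · rw [Finset.sum_eq_single_of_mem y h fun z _ hz => F.gapAt_mul_of_ne hz.symm,
      F.gapAt_mul_self]
  · exact Finset.sum_eq_zero fun z hz => F.gapAt_mul_of_ne fun h' => h (h' ▸ hz)

open scoped Classical in
theorem gap_union (T U : Finset (G.Y X)) :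
    F.gap (T ∪ U) = F.gap T + F.gap U - F.gap (T ∩ U) :=
  eq_sub_of_add_eq Finset.sum_union_inter

open scoped Classical in
theorem p_mul_gap (A : G.E) (T : Finset (G.Y X)) :
    F.p A * F.gap T = F.gap {y ∈ T | y.1 ∈ A.1} := by
  rw [gap, gap, Finset.mul_sum, Finset.sum_filter]
  refine Finset.sum_congr rfl fun y _ => ?_
  split_ifs with h
  · exact F.p_mul_gapAt_of_mem h
  · exact F.p_mul_gapAt_of_notMem h

theorem map_gap (π : 𝔄 →⋆ₙₐ[ℂ] 𝔅) (T : Finset (G.Y X)) : (F.map π).gap T = π (F.gap T) := by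
  simp only [gap, gapAt, map, map_sum, map_sub, map_mul, map_star]

end RelFamily

/-! ### Splitting a projection along `Y` -/

/-- The finite set `A ∩ Y`, as a set of elements of `Y`. -/
noncomputable def trace (hfin : ∀ e, (G.ran e ∩ G.Y X).Finite) (A : G.E) : Finset (G.Y X) :=
  ((finite_inter_Y hfin A.2).preimage (Subtype.val_injective.injOn) :
    ((Subtype.val : G.Y X → G.Vert) ⁻¹' (A.1 ∩ G.Y X)).Finite).toFinset

theorem mem_trace (hfin : ∀ e, (G.ran e ∩ G.Y X).Finite) (A : G.E) (y : G.Y X) :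
    y ∈ trace hfin A ↔ y.1 ∈ A.1 := by
  simp [trace]

open scoped Classical in
theorem trace_inter (hfin : ∀ e, (G.ran e ∩ G.Y X).Finite) (A B : G.E) :
    trace hfin (capE A B) = trace hfin A ∩ trace hfin B := by
  ext y; simp [mem_trace, val_capE]

open scoped Classical in
theorem trace_union (hfin : ∀ e, (G.ran e ∩ G.Y X).Finite) (A B : G.E) :
    trace hfin (cupE A B) = trace hfin A ∪ trace hfin B := by
  ext y; simp [mem_trace, val_cupE]

namespace RelFamily

variable (F : RelFamily G X 𝔄) (hfin : ∀ e, (G.ran e ∩ G.Y X).Finite)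

/-- The projection `p_A - ∑_{y ∈ A ∩ Y} q_y`, the part of `p_A` that is orthogonal to all gap
projections. -/
noncomputable def core (A : G.E) : 𝔄 := F.p A - F.gap (trace hfin A)

theorem star_core (A : G.E) : star (F.core hfin A) = F.core hfin A := by
  rw [core, star_sub, F.star_p, F.star_gap]

theorem core_add_gap (A : G.E) : F.core hfin A + F.gap (trace hfin A) = F.p A :=
  sub_add_cancel _ _

theorem p_mul_gap_trace (A B : G.E) :
    F.p A * F.gap (trace hfin B) = F.gap (trace hfin A) * F.gap (trace hfin B) := by
  classical
  rw [p_mul_gap, gap_mul_gap]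
  congr 1
  ext y
  simp [mem_trace, and_comm]

theorem gap_trace_mul_p (A B : G.E) :
    F.gap (trace hfin B) * F.p A = F.gap (trace hfin B) * F.gap (trace hfin A) := by
  simpa only [star_mul, F.star_p, F.star_gap] using congrArg star (F.p_mul_gap_trace hfin A B)

theorem core_mul_gap (A : G.E) (T : Finset (G.Y X)) : F.core hfin A * F.gap T = 0 := by
  classical
  rw [core, sub_mul, p_mul_gap, gap_mul_gap, sub_eq_zero]
  congr 1
  ext y
  simp [mem_trace, and_comm]

theorem gap_mul_core (A : G.E) (T : Finset (G.Y X)) : F.gap T * F.core hfin A = 0 := by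
  simpa only [star_mul, F.star_core, F.star_gap, star_zero]
    using congrArg star (F.core_mul_gap hfin A T)

/-- In `(p_A - Q_A)(p_B - Q_B)`, with `Q` the gap, the core kills `Q_B`, and
`Q_A p_B = Q_A Q_B = Q_{A ∩ B}`. -/
theorem core_mul_core (A B : G.E) :
    F.core hfin A * F.core hfin B = F.core hfin (capE A B) := by
  classical
  rw [core.eq_def F hfin B, mul_sub, core_mul_gap, sub_zero, core, core, sub_mul,
    gap_trace_mul_p, F.p_mul_p, gap_mul_gap, trace_inter, Finset.inter_comm]

theorem core_union (A B : G.E) :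
    F.core hfin (cupE A B) =
      F.core hfin A + F.core hfin B - F.core hfin (capE A B) := by
  classical
  simp only [core, F.p_cupE, trace_union, trace_inter, gap_union]
  abel

theorem core_mul_self (A : G.E) : F.core hfin A * F.core hfin A = F.core hfin A := by
  rw [core_mul_core]
  congr 1
  exact Subtype.ext (Set.inter_self _)

theorem gap_mul_self (T : Finset (G.Y X)) : F.gap T * F.gap T = F.gap T := by
  classical
  rw [gap_mul_gap, Finset.inter_self]

theorem core_mul_s {A : G.E} {e : G.Edge} (h : G.src e ∈ A.1) :
    F.core hfin A * F.s e = F.s e := by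
  rw [core, sub_mul, F.p_mul_s_of_mem h, F.gap_mul_s, sub_zero]

theorem p_mul_core (A : G.E) : F.p A * F.core hfin A = F.core hfin A := by
  rw [core, mul_sub, p_mul_gap_trace, gap_mul_self, F.p_mul_self]

/-- At a regular vertex the core of `p_v` is `∑_{s(e) = v} s_e s_e^*`: on `X` this is the
Cuntz–Krieger relation, and on `Y` it is the definition of the gap projection. -/
theorem core_vertex {v : G.Vert} (hv : v ∈ G.Reg) (h : (G.src ⁻¹' {v}).Finite) :
    F.core hfin (vertE v) = ∑ e ∈ h.toFinset, F.s e * star (F.s e) := by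
  by_cases hX : v ∈ X
  · have : trace hfin (vertE v) = (∅ : Finset (G.Y X)) := by
      ext y
      simp only [mem_trace, val_vertE, Set.mem_singleton_iff, Finset.notMem_empty, iff_false]
      rintro rfl
      exact y.2.2 hX
    rw [core, this, gap, Finset.sum_empty, sub_zero, show F.p (vertE v) = _ from F.ck v hX h]
  · have : trace hfin (vertE v) = ({⟨v, hv, hX⟩} : Finset (G.Y X)) := by
      ext y
      simp [mem_trace, val_vertE, Subtype.ext_iff]
    rw [core, this, gap, Finset.sum_singleton, gapAt, sub_sub_cancel]

end RelFamily


/-! ### Edges and vertex sets of the extended ultragraph -/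

theorem reg_of_inl_mem_reg {v : G.Vert} (hv : (Sum.inl v : G.Vert ⊕ G.Y X) ∈ (G.ext X).Reg) :
    v ∈ G.Reg := by
  obtain ⟨⟨e, he⟩, hf⟩ := hv
  constructor
  · rcases e with e | e
    · exact ⟨e, Sum.inl_injective he⟩
    · exact ⟨e.1, Sum.inl_injective he⟩
  · refine (hf.preimage (f := (Sum.inl : G.Edge → (G.ext X).Edge))
      Sum.inl_injective.injOn).subset fun e he => ?_
    exact congrArg Sum.inl he

theorem inr_notMem_reg (y : G.Y X) : (Sum.inr y : G.Vert ⊕ G.Y X) ∉ (G.ext X).Reg := by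
  rintro ⟨⟨e, he⟩, -⟩
  rcases e with e | e
  · exact Sum.inl_ne_inr he
  · exact Sum.inl_ne_inr he

theorem inl_mem_reg {v : G.Vert} (hv : v ∈ G.Reg) :
    (Sum.inl v : G.Vert ⊕ G.Y X) ∈ (G.ext X).Reg := by
  obtain ⟨⟨e, he⟩, hf⟩ := hv
  refine ⟨⟨Sum.inl e, congrArg Sum.inl he⟩, ?_⟩
  refine ((hf.image Sum.inl).union
    ((hf.preimage (Subtype.val_injective.injOn)).image Sum.inr)).subset ?_
  rintro (f | f) hf
  · exact Or.inl ⟨f, Sum.inl_injective hf, rfl⟩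
  · exact Or.inr ⟨f, Sum.inl_injective hf, rfl⟩

/-- A sum over `s ⊔ {a' : a ∈ s, P a}`, as a sum over `s` in which `a` and its copy `a'` are taken
together. -/
theorem sum_sum_subtype {α : Type*} {P : α → Prop} {M : Type*} [AddCommMonoid M] {s : Finset α}
    {t : Finset (α ⊕ {a // P a})} (hl : ∀ a, Sum.inl a ∈ t ↔ a ∈ s)
    (hr : ∀ a, Sum.inr a ∈ t ↔ a.1 ∈ s) (f : α ⊕ {a // P a} → M) (g : α → M)
    (hg : ∀ a ha, f (Sum.inr ⟨a, ha⟩) = g a) (hg' : ∀ a, ¬ P a → g a = 0) :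
    ∑ a ∈ t, f a = ∑ a ∈ s, (f (Sum.inl a) + g a) := by
  classical
  have ht : t = s.disjSum (s.subtype P) := by
    ext a
    rcases a with a | a
    · rw [Finset.inl_mem_disjSum, hl]
    · rw [Finset.inr_mem_disjSum, hr, Finset.mem_subtype]
  rw [ht, Finset.sum_disjSum, Finset.sum_add_distrib]
  congr 1
  calc ∑ a ∈ s.subtype P, f (Sum.inr a)
      = ∑ a ∈ s.subtype P, g a := Finset.sum_congr rfl fun a _ => hg a.1 a.2
    _ = ∑ a ∈ s with P a, g a := Finset.sum_subtype_eq_sum_filter _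
    _ = ∑ a ∈ s, g a :=
        Finset.sum_filter_of_ne fun a _ ha => by
          by_contra hc
          exact ha (hg' a hc)

/-- A sum over the edges of `G_X` that start at an old vertex `v`, as a sum over the edges of `G`
that start at `v`: every such edge `e` contributes itself and its copy `e'`, if there is one. -/
theorem sum_src_ext {v : G.Vert} (h : (G.src ⁻¹' {v}).Finite)
    (h' : ((G.ext X).src ⁻¹' {(Sum.inl v : G.Vert ⊕ G.Y X)}).Finite)
    (f : (G.ext X).Edge → 𝔄) (g : G.Edge → 𝔄)
    (hg : ∀ e he, f (Sum.inr ⟨e, he⟩) = g e)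
    (hg' : ∀ e, ¬ (G.ran e ∩ G.Y X).Nonempty → g e = 0) :
    ∑ e ∈ h'.toFinset, f e = ∑ e ∈ h.toFinset, (f (Sum.inl e) + g e) :=
  sum_sum_subtype
    (fun _ => h'.mem_toFinset.trans <| Iff.trans Sum.inl_injective.eq_iff h.mem_toFinset.symm)
    (fun _ => h'.mem_toFinset.trans <| Iff.trans Sum.inl_injective.eq_iff h.mem_toFinset.symm)
    f g hg hg'

theorem disjoint_inlE_primeE (A B : G.E) : Disjoint (inlE X A).1 (primeE X B).1 := by
  rw [Set.disjoint_left]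
  rintro _ ⟨a, -, rfl⟩ ⟨y, -, h⟩
  exact Sum.inl_ne_inr h

theorem val_primeE (A : G.E) :
    (primeE X A).1 = (Sum.inr : G.Y X → G.Vert ⊕ G.Y X) '' {y | y.1 ∈ A.1} := by
  ext w
  exact ⟨fun ⟨v, hv, h⟩ => ⟨v, hv, h.symm⟩, fun ⟨v, hv, h⟩ => ⟨v, hv, h.symm⟩⟩

theorem primeE_capE (A B : G.E) : primeE X (capE A B) = capE (primeE X A) (primeE X B) := by
  refine Subtype.ext ?_
  change _ = (primeE X A).1 ∩ (primeE X B).1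
  rw [val_primeE, val_primeE, val_primeE]
  exact Eq.trans (b := Sum.inr '' ({y | y.1 ∈ A.1} ∩ {y | y.1 ∈ B.1})) rfl
    (Set.image_inter Sum.inr_injective)

theorem primeE_cupE (A B : G.E) : primeE X (cupE A B) = cupE (primeE X A) (primeE X B) := by
  refine Subtype.ext ?_
  change _ = (primeE X A).1 ∪ (primeE X B).1
  rw [val_primeE, val_primeE, val_primeE]
  exact Eq.trans (b := Sum.inr '' ({y | y.1 ∈ A.1} ∪ {y | y.1 ∈ B.1})) rfl (Set.image_union ..)

theorem inlE_capE (A B : G.E) : inlE X (capE A B) = capE (inlE X A) (inlE X B) :=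
  Subtype.ext (Set.image_inter Sum.inl_injective)

theorem inlE_cupE (A B : G.E) : inlE X (cupE A B) = cupE (inlE X A) (inlE X B) :=
  Subtype.ext (Set.image_union ..)

theorem memE_preimage_inl {Z : Set (G.ext X).Vert} (hZ : (G.ext X).MemE Z) :
    G.MemE ((Sum.inl : G.Vert → (G.ext X).Vert) ⁻¹' Z) := by
  induction hZ with
  | empty => exact .empty
  | vertex v =>
    rcases v with v | y
    · have : (Sum.inl : G.Vert → (G.ext X).Vert) ⁻¹' {Sum.inl v} = {v} := by
        ext w
        exact Sum.inl_injective.eq_iff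
      exact (congrArg G.MemE this).mpr (.vertex v)
    · have : (Sum.inl : G.Vert → (G.ext X).Vert) ⁻¹' {Sum.inr y} = ∅ :=
        Set.eq_empty_of_forall_notMem fun w hw => Sum.inl_ne_inr hw
      exact (congrArg G.MemE this).mpr (.empty)
  | range e =>
    rcases e with e | e
    · have : (Sum.inl : G.Vert → (G.ext X).Vert) ⁻¹' ((G.ext X).ran (Sum.inl e)) = G.ran e :=
        Set.preimage_image_eq _ Sum.inl_injective
      exact (congrArg G.MemE this).mpr (.range e)
    · have : (Sum.inl : G.Vert → (G.ext X).Vert) ⁻¹' ((G.ext X).ran (Sum.inr e)) = ∅ :=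
        Set.eq_empty_of_forall_notMem fun w ⟨_, _, hw⟩ => Sum.inl_ne_inr hw
      exact (congrArg G.MemE this).mpr (.empty)
  | union _ _ hA hB => exact hA.union hB
  | inter _ _ hA hB => exact hA.inter hB

theorem finite_preimage_inr (hfin : ∀ e, (G.ran e ∩ G.Y X).Finite) {Z : Set (G.ext X).Vert}
    (hZ : (G.ext X).MemE Z) : ((Sum.inr : G.Y X → (G.ext X).Vert) ⁻¹' Z).Finite := by
  induction hZ with
  | empty => exact Set.finite_empty
  | vertex v => exact (Set.finite_singleton v).preimage Sum.inr_injective.injOn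
  | range e =>
    rcases e with e | e
    · refine Set.finite_empty.subset ?_
      rintro y ⟨w, -, hw⟩
      exact Sum.inl_ne_inr hw
    · refine (trace hfin (ranE e.1)).finite_toSet.subset ?_
      rintro y ⟨w, hw, h⟩
      obtain rfl := Sum.inr_injective h
      exact (mem_trace hfin _ _).2 hw
  | union _ _ hA hB => exact hA.union hB
  | inter _ _ hA _ => exact hA.subset fun _ h => h.1

/-- The set `Z ∩ G⁰` of old vertices of `Z ∈ 𝓔_X`, as a member of `𝓔`. -/
def oldPart (Z : (G.ext X).E) : G.E := ⟨Sum.inl ⁻¹' Z.1, memE_preimage_inl Z.2⟩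

/-- The finite set `{y ∈ Y : y' ∈ Z}`, for `Z ∈ 𝓔_X`. -/
noncomputable def newPart (hfin : ∀ e, (G.ran e ∩ G.Y X).Finite) (Z : (G.ext X).E) :
    Finset (G.Y X) := (finite_preimage_inr hfin Z.2).toFinset

theorem mem_newPart (hfin : ∀ e, (G.ran e ∩ G.Y X).Finite) (Z : (G.ext X).E) (y : G.Y X) :
    y ∈ newPart hfin Z ↔ (Sum.inr y : G.Vert ⊕ G.Y X) ∈ Z.1 :=
  Set.Finite.mem_toFinset _

theorem oldPart_capE (Z W : (G.ext X).E) :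
    oldPart (capE Z W) = capE (oldPart Z) (oldPart W) := rfl

theorem oldPart_cupE (Z W : (G.ext X).E) :
    oldPart (cupE Z W) = cupE (oldPart Z) (oldPart W) := rfl

open scoped Classical in
theorem newPart_capE (hfin : ∀ e, (G.ran e ∩ G.Y X).Finite) (Z W : (G.ext X).E) :
    newPart hfin (capE Z W) = newPart hfin Z ∩ newPart hfin W := by
  ext y
  rw [Finset.mem_inter, mem_newPart, mem_newPart, mem_newPart]
  rfl

open scoped Classical in
theorem newPart_cupE (hfin : ∀ e, (G.ran e ∩ G.Y X).Finite) (Z W : (G.ext X).E) :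
    newPart hfin (cupE Z W) = newPart hfin Z ∪ newPart hfin W := by
  ext y
  rw [Finset.mem_union, mem_newPart, mem_newPart, mem_newPart]
  rfl

theorem inl_mem_unionE (A B : G.E) (v : G.Vert) :
    (Sum.inl v : G.Vert ⊕ G.Y X) ∈ (unionE X A B).1 ↔ v ∈ A.1 := by
  refine ⟨?_, fun h => Or.inl ⟨v, h, rfl⟩⟩
  rintro (⟨w, hw, h⟩ | ⟨y, -, h⟩)
  · exact Sum.inl_injective h ▸ hw
  · exact (Sum.inl_ne_inr h).elim

theorem inr_mem_unionE (A B : G.E) (y : G.Y X) :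
    (Sum.inr y : G.Vert ⊕ G.Y X) ∈ (unionE X A B).1 ↔ y.1 ∈ B.1 := by
  refine ⟨?_, fun h => Or.inr ⟨y, h, rfl⟩⟩
  rintro (⟨w, hw, h⟩ | ⟨z, hz, h⟩)
  · exact (Sum.inl_ne_inr h).elim
  · exact Sum.inr_injective h ▸ hz

theorem oldPart_unionE (A B : G.E) : oldPart (unionE X A B) = A :=
  Subtype.ext (Set.ext fun v => inl_mem_unionE A B v)

theorem newPart_unionE (hfin : ∀ e, (G.ran e ∩ G.Y X).Finite) (A B : G.E) :
    newPart hfin (unionE X A B) = trace hfin B := by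
  ext y
  rw [mem_newPart, mem_trace, inr_mem_unionE]

/-- Every member of `𝓔_X` has the form `A ∪ (B ∩ Y)'` with `A, B ∈ 𝓔`. -/
theorem exists_eq_unionE (hfin : ∀ e, (G.ran e ∩ G.Y X).Finite) (Z : (G.ext X).E) :
    ∃ A B : G.E, Z = unionE X A B := by
  -- As `B` one can take the finite set `{y ∈ Y : y' ∈ Z}` itself.
  refine ⟨oldPart Z, ⟨Subtype.val '' (newPart hfin Z : Set (G.Y X)),
    memE_of_finite ((newPart hfin Z).finite_toSet.image _)⟩, Subtype.ext (Set.ext ?_)⟩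
  rintro (v | y)
  · exact (inl_mem_unionE (oldPart Z) _ v).symm
  · refine Iff.trans ?_ (inr_mem_unionE _ _ y).symm
    refine (mem_newPart hfin Z y).symm.trans ⟨fun h => ⟨y, h, rfl⟩, ?_⟩
    rintro ⟨z, hz, h⟩
    exact Subtype.ext h ▸ hz

/-- The empty set, as a member of `𝓔`. -/
def emptyE : G.E := ⟨∅, .empty⟩

theorem inlE_eq_unionE (A : G.E) : inlE X A = unionE X A emptyE := by
  refine Subtype.ext (Set.ext ?_)
  rintro (v | y)
  · exact Iff.trans ⟨fun ⟨w, hw, h⟩ => Sum.inl_injective h ▸ hw, fun h => ⟨v, h, rfl⟩⟩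
      (inl_mem_unionE _ _ v).symm
  · exact iff_of_false (fun ⟨w, _, h⟩ => Sum.inl_ne_inr h) fun h => (inr_mem_unionE _ _ y).1 h

theorem primeE_eq_unionE (B : G.E) : primeE X B = unionE X emptyE B := by
  refine Subtype.ext (Set.ext ?_)
  rintro (v | y)
  · exact iff_of_false (fun ⟨w, _, h⟩ => Sum.inl_ne_inr h) fun h => (inl_mem_unionE _ _ v).1 h
  · exact Iff.trans ⟨fun ⟨w, hw, h⟩ => Sum.inr_injective h ▸ hw, fun h => ⟨y, h, rfl⟩⟩
      (inr_mem_unionE _ _ y).symm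


/-! ### From families for the extended ultragraph to families for the relative one -/

namespace RelFamily

section Glue

variable (F : RelFamily (G.ext X) (G.ext X).Reg 𝔄)

/-- The element `S_e` of a family for `G_X`, for an old edge `e`. -/
def sOld (e : G.Edge) : 𝔄 := F.s (Sum.inl e)

open scoped Classical in
/-- The element `S_{e'}` of a family for `G_X`, read as `0` if `e` has no copy `e'`. -/
noncomputable def sNew (e : G.Edge) : 𝔄 :=
  if he : (G.ran e ∩ G.Y X).Nonempty then F.s (Sum.inr ⟨e, he⟩) else 0

theorem sNew_of_nonempty {e : G.Edge} (he : (G.ran e ∩ G.Y X).Nonempty) :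
    F.sNew e = F.s (Sum.inr ⟨e, he⟩) := dif_pos he

theorem sNew_of_not_nonempty {e : G.Edge} (he : ¬ (G.ran e ∩ G.Y X).Nonempty) :
    F.sNew e = 0 := dif_neg he

theorem p_primeE_eq_zero {A : G.E} (h : ¬ (A.1 ∩ G.Y X).Nonempty) : F.p (primeE X A) = 0 := by
  refine F.p_eq_zero (Set.eq_empty_of_forall_notMem ?_)
  rintro _ ⟨y, hy, -⟩
  exact h ⟨y, hy, y.2⟩

theorem p_inlE_mul_p_primeE (A B : G.E) : F.p (inlE X A) * F.p (primeE X B) = 0 :=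
  F.p_mul_p_of_disjoint (disjoint_inlE_primeE A B)

theorem p_primeE_mul_p_inlE (A B : G.E) : F.p (primeE X A) * F.p (inlE X B) = 0 :=
  F.p_mul_p_of_disjoint (disjoint_inlE_primeE B A).symm

theorem star_sOld_mul_sOld (e : G.Edge) :
    star (F.sOld e) * F.sOld e = F.p (inlE X (ranE e)) := F.star_s_mul_s _

theorem star_sNew_mul_sNew (e : G.Edge) :
    star (F.sNew e) * F.sNew e = F.p (primeE X (ranE e)) := by
  by_cases he : (G.ran e ∩ G.Y X).Nonempty
  · rw [F.sNew_of_nonempty he]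
    exact F.star_s_mul_s _
  · rw [F.sNew_of_not_nonempty he, F.p_primeE_eq_zero (A := ranE e) he, mul_zero]

theorem sOld_mul_p_ran (e : G.Edge) : F.sOld e * F.p (inlE X (ranE e)) = F.sOld e :=
  F.s_mul_p_ran _

theorem sNew_mul_p_ran (e : G.Edge) : F.sNew e * F.p (primeE X (ranE e)) = F.sNew e := by
  by_cases he : (G.ran e ∩ G.Y X).Nonempty
  · rw [F.sNew_of_nonempty he]
    exact F.s_mul_p_ran _
  · rw [F.sNew_of_not_nonempty he, zero_mul]

theorem sOld_mul_p_primeE (e : G.Edge) (A : G.E) : F.sOld e * F.p (primeE X A) = 0 := by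
  rw [← F.sOld_mul_p_ran, mul_assoc, F.p_inlE_mul_p_primeE, mul_zero]

theorem sNew_mul_p_inlE (e : G.Edge) (A : G.E) : F.sNew e * F.p (inlE X A) = 0 := by
  rw [← F.sNew_mul_p_ran, mul_assoc, F.p_primeE_mul_p_inlE, mul_zero]

theorem star_sOld_mul_sNew (e f : G.Edge) : star (F.sOld e) * F.sNew f = 0 := by
  by_cases hf : (G.ran f ∩ G.Y X).Nonempty
  · rw [F.sNew_of_nonempty hf]
    exact F.star_s_mul_s_of_ne Sum.inl_ne_inr
  · rw [F.sNew_of_not_nonempty hf, mul_zero]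

theorem star_sNew_mul_sOld (e f : G.Edge) : star (F.sNew e) * F.sOld f = 0 := by
  simpa only [star_mul, star_star, star_zero] using congrArg star (F.star_sOld_mul_sNew f e)

theorem star_sOld_mul_sOld_of_ne {e f : G.Edge} (h : e ≠ f) :
    star (F.sOld e) * F.sOld f = 0 :=
  F.star_s_mul_s_of_ne fun h' => h (Sum.inl_injective h')

theorem star_sNew_mul_sNew_of_ne {e f : G.Edge} (h : e ≠ f) :
    star (F.sNew e) * F.sNew f = 0 := by
  by_cases he : (G.ran e ∩ G.Y X).Nonempty
  · by_cases hf : (G.ran f ∩ G.Y X).Nonempty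
    · rw [F.sNew_of_nonempty he, F.sNew_of_nonempty hf]
      exact F.star_s_mul_s_of_ne fun h' => h (congrArg Subtype.val (Sum.inr_injective h'))
    · rw [F.sNew_of_not_nonempty hf, mul_zero]
  · rw [F.sNew_of_not_nonempty he, star_zero, zero_mul]

/-- The ranges `r(e)` and `(r(e) ∩ Y)'` are disjoint, so there are no mixed terms in
`(S_e + S_{e'})(S_e + S_{e'})^*`. -/
theorem sOld_mul_star_sNew (e : G.Edge) : F.sOld e * star (F.sNew e) = 0 := by
  rw [← F.sNew_mul_p_ran, star_mul, F.star_p, ← mul_assoc, F.sOld_mul_p_primeE, zero_mul]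

theorem sNew_mul_star_sOld (e : G.Edge) : F.sNew e * star (F.sOld e) = 0 := by
  simpa only [star_mul, star_star, star_zero] using congrArg star (F.sOld_mul_star_sNew e)

theorem p_src_mul_sOld (e : G.Edge) :
    F.p (inlE X (vertE (G.src e))) * F.sOld e = F.sOld e :=
  F.p_mul_s_of_mem (Set.mem_image_of_mem _ (Set.mem_singleton _))

theorem p_src_mul_sNew (e : G.Edge) :
    F.p (inlE X (vertE (G.src e))) * F.sNew e = F.sNew e := by
  by_cases he : (G.ran e ∩ G.Y X).Nonempty
  · rw [F.sNew_of_nonempty he]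
    exact F.p_mul_s_of_mem (Set.mem_image_of_mem _ (Set.mem_singleton _))
  · rw [F.sNew_of_not_nonempty he, mul_zero]

theorem p_primeE_mul_sOld (A : G.E) (e : G.Edge) : F.p (primeE X A) * F.sOld e = 0 := by
  rw [← F.p_src_mul_sOld, ← mul_assoc, F.p_primeE_mul_p_inlE, zero_mul]

theorem p_primeE_mul_sNew (A : G.E) (e : G.Edge) : F.p (primeE X A) * F.sNew e = 0 := by
  rw [← F.p_src_mul_sNew, ← mul_assoc, F.p_primeE_mul_p_inlE, zero_mul]

theorem sOld_add_sNew_mul_star (e : G.Edge) :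
    (F.sOld e + F.sNew e) * star (F.sOld e + F.sNew e) =
      F.sOld e * star (F.sOld e) + F.sNew e * star (F.sNew e) := by
  rw [star_add, add_mul, mul_add, mul_add, F.sOld_mul_star_sNew, F.sNew_mul_star_sOld, add_zero,
    zero_add]

theorem star_sOld_add_sNew_mul (e : G.Edge) :
    star (F.sOld e + F.sNew e) * (F.sOld e + F.sNew e) =
      F.p (inlE X (ranE e)) + F.p (primeE X (ranE e)) := by
  rw [star_add, add_mul, mul_add, mul_add, F.star_sOld_mul_sNew, F.star_sNew_mul_sOld,
    F.star_sOld_mul_sOld, F.star_sNew_mul_sNew, add_zero, zero_add]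

theorem star_sOld_add_sNew_mul_of_ne {e f : G.Edge} (h : e ≠ f) :
    star (F.sOld e + F.sNew e) * (F.sOld f + F.sNew f) = 0 := by
  rw [star_add, add_mul, mul_add, mul_add, F.star_sOld_mul_sNew, F.star_sNew_mul_sOld,
    F.star_sOld_mul_sOld_of_ne h, F.star_sNew_mul_sNew_of_ne h, add_zero, add_zero]

/-- The Cuntz–Krieger relation of `G_X` at an old vertex that is regular in `G`. -/
theorem p_inlE_vertE {v : G.Vert} (hv : v ∈ G.Reg) (h : (G.src ⁻¹' {v}).Finite) :
    F.p (inlE X (vertE v)) =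
      ∑ e ∈ h.toFinset, (F.sOld e + F.sNew e) * star (F.sOld e + F.sNew e) := by
  have hv' := inl_mem_reg (X := X) hv
  have h1 : F.p (inlE X (vertE v)) = F.p (vertE (G := G.ext X) (Sum.inl v)) :=
    F.p_congr Set.image_singleton
  have h2 : F.p (vertE (G := G.ext X) (Sum.inl v)) = _ := F.ck _ hv' hv'.2
  rw [h1, h2, sum_src_ext h hv'.2 _ (fun e => F.sNew e * star (F.sNew e))]
  · exact Finset.sum_congr rfl fun e _ => (F.sOld_add_sNew_mul_star e).symm
  · intro e he
    rw [F.sNew_of_nonempty he]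
  · intro e he
    rw [F.sNew_of_not_nonempty he, zero_mul]

/-- A family for `G_X` gives the family `p_B = P_B + P_{(B ∩ Y)'}`, `s_e = S_e + S_{e'}` for
`(G, X)`. -/
noncomputable def glue (hX : X ⊆ G.Reg) : RelFamily G X 𝔄 where
  s e := F.sOld e + F.sNew e
  p B := F.p (inlE X B) + F.p (primeE X B)
  s_partial e := by
    rw [mul_assoc, star_sOld_add_sNew_mul, add_mul, mul_add, mul_add, F.sOld_mul_p_ran,
      F.sNew_mul_p_ran, F.sOld_mul_p_primeE, F.sNew_mul_p_inlE, add_zero, zero_add]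
  s_orth e f h := by
    rw [mul_assoc, ← mul_assoc (star _), F.star_sOld_add_sNew_mul_of_ne h, zero_mul, mul_zero]
  p_proj A := by
    constructor
    · change _ * _ = _
      rw [add_mul, mul_add, mul_add, F.p_inlE_mul_p_primeE, F.p_primeE_mul_p_inlE, F.p_mul_self,
        F.p_mul_self, add_zero, zero_add]
    · change star _ = _
      rw [star_add, F.star_p, F.star_p]
  p_empty := by
    rw [F.p_eq_zero (A := inlE X ⟨∅, .empty⟩) (Set.image_empty _), zero_add]
    exact F.p_primeE_eq_zero (A := emptyE) fun ⟨_, h, _⟩ => h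
  p_inter A B := by
    change _ = F.p (inlE X (capE A B)) + F.p (primeE X (capE A B))
    rw [add_mul, mul_add, mul_add, F.p_inlE_mul_p_primeE, F.p_primeE_mul_p_inlE, F.p_mul_p,
      F.p_mul_p, add_zero, zero_add, inlE_capE, primeE_capE]
  p_union A B := by
    change F.p (inlE X (cupE A B)) + F.p (primeE X (cupE A B)) =
      _ - (F.p (inlE X (capE A B)) + F.p (primeE X (capE A B)))
    rw [inlE_cupE, primeE_cupE, inlE_capE, primeE_capE, F.p_cupE, F.p_cupE]
    abel
  star_s_mul_s e := F.star_sOld_add_sNew_mul e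
  s_le e := by
    change (F.p (inlE X (vertE (G.src e))) + F.p (primeE X (vertE (G.src e)))) * _ = _
    rw [← mul_assoc, add_mul (F.p _), mul_add (F.p _), mul_add (F.p _), F.p_src_mul_sOld,
      F.p_src_mul_sNew, F.p_primeE_mul_sOld, F.p_primeE_mul_sNew, add_zero, add_zero]
  ck v hv h := by
    change F.p (inlE X (vertE v)) + F.p (primeE X (vertE v)) = _
    rw [F.p_inlE_vertE (hX hv) h, F.p_primeE_eq_zero (A := vertE v), add_zero]
    rintro ⟨_, rfl, hw⟩
    exact hw.2 hv

theorem glue_s (hX : X ⊆ G.Reg) (e : G.Edge) : (F.glue hX).s e = F.sOld e + F.sNew e := rfl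

theorem glue_p (hX : X ⊆ G.Reg) (B : G.E) :
    (F.glue hX).p B = F.p (inlE X B) + F.p (primeE X B) := rfl

theorem map_glue (hX : X ⊆ G.Reg) (π : 𝔄 →⋆ₙₐ[ℂ] 𝔅) :
    (F.map π).glue hX = (F.glue hX).map π := by
  refine eq_of_s_p (fun e => ?_) fun A => ?_
  · change (F.map π).sOld e + (F.map π).sNew e = π (F.sOld e + F.sNew e)
    rw [map_add]
    congr 1
    by_cases he : (G.ran e ∩ G.Y X).Nonempty
    · rw [F.sNew_of_nonempty he, sNew_of_nonempty _ he]
      rfl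
    · rw [F.sNew_of_not_nonempty he, sNew_of_not_nonempty _ he, map_zero]
  · exact (map_add π _ _).symm

/-- The gap projection at `y` of the glued family is the projection of the new vertex `y'`. -/
theorem glue_gapAt (hX : X ⊆ G.Reg) (y : G.Y X) :
    (F.glue hX).gapAt y = F.p (vertE (G := G.ext X) (Sum.inr y)) := by
  have h : F.p (vertE (G := G.ext X) (Sum.inr y)) = F.p (primeE X (vertE y.1)) := by
    refine F.p_congr ?_
    rw [val_primeE]
    refine Eq.symm (Eq.trans (congrArg _ ?_) Set.image_singleton)
    ext z
    exact Subtype.ext_iff.symm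
  rw [gapAt, glue_p, F.p_inlE_vertE y.2.1 y.2.1.2, h, add_comm]
  exact add_sub_cancel_right _ _

theorem glue_gap (hX : X ⊆ G.Reg) (T : Finset (G.Y X)) (A : (G.ext X).E)
    (hA : A.1 = (Sum.inr : G.Y X → G.Vert ⊕ G.Y X) '' T) : (F.glue hX).gap T = F.p A :=
  (Finset.sum_congr rfl fun y _ => F.glue_gapAt hX y).trans
    (F.p_image_finset (Sum.inr : G.Y X → (G.ext X).Vert) Sum.inr_injective T A hA).symm

theorem glue_gap_trace (hX : X ⊆ G.Reg) (hfin : ∀ e, (G.ran e ∩ G.Y X).Finite) (A : G.E) :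
    (F.glue hX).gap (trace hfin A) = F.p (primeE X A) := by
  refine F.glue_gap hX _ _ ?_
  rw [val_primeE]
  congr 1
  ext y
  exact (mem_trace hfin A y).symm

theorem glue_core (hX : X ⊆ G.Reg) (hfin : ∀ e, (G.ran e ∩ G.Y X).Finite) (A : G.E) :
    (F.glue hX).core hfin A = F.p (inlE X A) := by
  rw [core, glue_gap_trace, glue_p, add_sub_cancel_right]

end Glue

/-! ### From families for the relative ultragraph to families for the extended one -/

section Split

variable (F : RelFamily G X 𝔄) (hfin : ∀ e, (G.ran e ∩ G.Y X).Finite)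

/-- The projections `P_Z` of the split family. -/
noncomputable def splitP (Z : (G.ext X).E) : 𝔄 :=
  F.core hfin (oldPart Z) + F.gap (newPart hfin Z)

/-- The partial isometries of the split family: `s_e` cut down by the core and by the gap of its
initial projection. -/
noncomputable def splitS : (G.ext X).Edge → 𝔄 :=
  Sum.elim (fun e => F.s e * F.core hfin (ranE e))
    (fun e => F.s e.1 * F.gap (trace hfin (ranE e.1)))

theorem splitS_inl (e : G.Edge) :
    F.splitS hfin (Sum.inl e) = F.s e * F.core hfin (ranE e) := rfl

theorem splitS_inr (e : {e : G.Edge // (G.ran e ∩ G.Y X).Nonempty}) :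
    F.splitS hfin (Sum.inr e) = F.s e.1 * F.gap (trace hfin (ranE e.1)) := rfl

theorem trace_emptyE : trace hfin emptyE = ∅ :=
  Finset.eq_empty_of_forall_notMem fun y hy => (mem_trace hfin emptyE y).1 hy

theorem gap_empty : F.gap ∅ = 0 := Finset.sum_empty

theorem core_emptyE : F.core hfin emptyE = 0 := by
  rw [core, trace_emptyE, gap_empty, sub_zero]
  exact F.p_empty

theorem splitP_unionE (A B : G.E) :
    F.splitP hfin (unionE X A B) = F.core hfin A + F.gap (trace hfin B) := by
  rw [splitP, oldPart_unionE, newPart_unionE]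

theorem splitP_inlE (A : G.E) : F.splitP hfin (inlE X A) = F.core hfin A := by
  rw [inlE_eq_unionE, splitP_unionE, trace_emptyE, gap_empty, add_zero]

theorem splitP_primeE (B : G.E) : F.splitP hfin (primeE X B) = F.gap (trace hfin B) := by
  rw [primeE_eq_unionE, splitP_unionE, core_emptyE, zero_add]

theorem p_ran_mul_gap_trace (e : G.Edge) :
    F.p (ranE e) * F.gap (trace hfin (ranE e)) = F.gap (trace hfin (ranE e)) := by
  rw [p_mul_gap_trace, gap_mul_self]

theorem star_splitS_mul_splitS (e : (G.ext X).Edge) :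
    star (F.splitS hfin e) * F.splitS hfin e = F.splitP hfin (ranE e) := by
  rcases e with e | e
  · have h : F.splitP hfin (ranE (G := G.ext X) (Sum.inl e)) = F.core hfin (ranE e) :=
      F.splitP_inlE hfin (ranE e)
    have h1 : star (F.s e) * F.s e = F.p (ranE e) := F.star_s_mul_s e
    rw [h, splitS_inl, star_mul, star_core, mul_assoc, ← mul_assoc (star _), h1, p_mul_core,
      core_mul_self]
  · have h : F.splitP hfin (ranE (G := G.ext X) (Sum.inr e)) = F.gap (trace hfin (ranE e.1)) :=
      F.splitP_primeE hfin (ranE e.1)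
    have h1 : star (F.s e.1) * F.s e.1 = F.p (ranE e.1) := F.star_s_mul_s e.1
    rw [h, splitS_inr, star_mul, star_gap, mul_assoc, ← mul_assoc (star _), h1,
      p_ran_mul_gap_trace, gap_mul_self]

theorem splitS_mul_splitP_ran (e : (G.ext X).Edge) :
    F.splitS hfin e * F.splitP hfin (ranE e) = F.splitS hfin e := by
  rcases e with e | e
  · have h : F.splitP hfin (ranE (G := G.ext X) (Sum.inl e)) = F.core hfin (ranE e) :=
      F.splitP_inlE hfin (ranE e)
    rw [h, splitS_inl, mul_assoc, core_mul_self]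
  · have h : F.splitP hfin (ranE (G := G.ext X) (Sum.inr e)) = F.gap (trace hfin (ranE e.1)) :=
      F.splitP_primeE hfin (ranE e.1)
    rw [h, splitS_inr, mul_assoc, gap_mul_self]

theorem star_mul_s_mul_s_mul_of_ne {e f : G.Edge} (h : e ≠ f) (a b : 𝔄) :
    star (F.s e * a) * (F.s f * b) = 0 := by
  rw [star_mul, mul_assoc, ← mul_assoc (star (F.s e)), F.star_s_mul_s_of_ne h, zero_mul, mul_zero]

theorem star_splitS_inl_mul_splitS_inr (e : G.Edge)
    (f : {e : G.Edge // (G.ran e ∩ G.Y X).Nonempty}) :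
    star (F.splitS hfin (Sum.inl e)) * F.splitS hfin (Sum.inr f) = 0 := by
  rw [splitS_inl, splitS_inr]
  by_cases h : e = f.1
  · subst h
    have h1 : star (F.s f.1) * F.s f.1 = F.p (ranE f.1) := F.star_s_mul_s f.1
    rw [star_mul, star_core, mul_assoc, ← mul_assoc (star _), h1, p_ran_mul_gap_trace,
      core_mul_gap]
  · exact F.star_mul_s_mul_s_mul_of_ne h _ _

theorem star_splitS_mul_splitS_of_ne {e f : (G.ext X).Edge} (h : e ≠ f) :
    star (F.splitS hfin e) * F.splitS hfin f = 0 := by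
  rcases e with e | e <;> rcases f with f | f
  · exact F.star_mul_s_mul_s_mul_of_ne (fun h' => h (congrArg Sum.inl h')) _ _
  · exact F.star_splitS_inl_mul_splitS_inr hfin e f
  · simpa only [star_mul, star_star, star_zero]
      using congrArg star (F.star_splitS_inl_mul_splitS_inr hfin f e)
  · exact F.star_mul_s_mul_s_mul_of_ne (fun h' => h (congrArg Sum.inr (Subtype.ext h'))) _ _

theorem splitP_vertE_inl (v : G.Vert) :
    F.splitP hfin (vertE (G := G.ext X) (Sum.inl v)) = F.core hfin (vertE v) := by
  rw [← splitP_inlE]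
  exact congrArg _ (Subtype.ext Set.image_singleton.symm)

theorem splitP_src_mul_splitS (e : (G.ext X).Edge) :
    F.splitP hfin (vertE ((G.ext X).src e)) * F.splitS hfin e = F.splitS hfin e := by
  rcases e with e | e
  · have h : F.splitP hfin (vertE ((G.ext X).src (Sum.inl e))) = F.core hfin (vertE (G.src e)) :=
      F.splitP_vertE_inl hfin _
    rw [h, splitS_inl, ← mul_assoc, F.core_mul_s hfin (A := vertE (G.src e)) rfl]
  · have h : F.splitP hfin (vertE ((G.ext X).src (Sum.inr e))) =
        F.core hfin (vertE (G.src e.1)) := F.splitP_vertE_inl hfin _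
    rw [h, splitS_inr, ← mul_assoc, F.core_mul_s hfin (A := vertE (G.src e.1)) rfl]

/-- Core and gap of `p_{r(e)}` add up to `p_{r(e)}`, so the range projections of the two parts of
`s_e` add up to `s_e s_e^*`. -/
theorem splitS_mul_star_add (e : G.Edge) :
    F.s e * F.core hfin (ranE e) * star (F.s e * F.core hfin (ranE e)) +
      F.s e * F.gap (trace hfin (ranE e)) * star (F.s e * F.gap (trace hfin (ranE e))) =
      F.s e * star (F.s e) := by
  rw [star_mul, star_mul, star_core, star_gap, mul_assoc, ← mul_assoc (F.core hfin _),
    core_mul_self, mul_assoc (F.s e) (F.gap _), ← mul_assoc (F.gap _), gap_mul_self, ← mul_add,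
    ← add_mul, core_add_gap, p_ran_mul_star_s]

theorem trace_ranE_eq_empty {e : G.Edge} (he : ¬ (G.ran e ∩ G.Y X).Nonempty) :
    trace hfin (ranE e) = ∅ :=
  Finset.eq_empty_of_forall_notMem fun y hy => he ⟨y, (mem_trace hfin (ranE e) y).1 hy, y.2⟩

/-- A family for `(G, X)` gives a family for `G_X`: the old part of `P_Z` is a core projection, and
its new part is a sum of gap projections. -/
noncomputable def split : RelFamily (G.ext X) (G.ext X).Reg 𝔄 where
  s := F.splitS hfin
  p := F.splitP hfin
  s_partial e := by
    rw [mul_assoc, star_splitS_mul_splitS, splitS_mul_splitP_ran]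
  s_orth e f h := by
    rw [mul_assoc, ← mul_assoc (star _), F.star_splitS_mul_splitS_of_ne hfin h, zero_mul,
      mul_zero]
  p_proj Z := by
    constructor
    · change F.splitP hfin Z * F.splitP hfin Z = F.splitP hfin Z
      rw [splitP, add_mul, mul_add, mul_add, core_mul_gap, gap_mul_core, core_mul_self,
        gap_mul_self, add_zero, zero_add]
    · change star (F.splitP hfin Z) = F.splitP hfin Z
      rw [splitP, star_add, star_core, star_gap]
  p_empty := by
    have h : F.splitP hfin (inlE X emptyE) = 0 := by rw [splitP_inlE, core_emptyE]
    refine Eq.trans (congrArg _ (Subtype.ext ?_)) h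
    exact (Set.image_empty _).symm
  p_inter Z W := by
    classical
    change _ = F.splitP hfin (capE Z W)
    rw [splitP, splitP, splitP, add_mul, mul_add, mul_add, core_mul_gap, gap_mul_core,
      core_mul_core, gap_mul_gap, add_zero, zero_add, oldPart_capE,
      newPart_capE]
  p_union Z W := by
    classical
    change F.splitP hfin (cupE Z W) = _ - F.splitP hfin (capE Z W)
    simp only [splitP, oldPart_capE, oldPart_cupE, newPart_capE, newPart_cupE, core_union,
      gap_union]
    abel
  star_s_mul_s e := F.star_splitS_mul_splitS hfin e
  s_le e := by
    change F.splitP hfin (vertE ((G.ext X).src e)) * _ = _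
    rw [← mul_assoc, splitP_src_mul_splitS]
  ck v hv h := by
    rcases v with v | y
    · have hv' := reg_of_inl_mem_reg hv
      change F.splitP hfin (vertE (G := G.ext X) (Sum.inl v)) = _
      rw [splitP_vertE_inl, F.core_vertex hfin hv' hv'.2]
      refine Eq.symm ((sum_src_ext hv'.2 h _ (fun e => F.s e * F.gap (trace hfin (ranE e)) *
        star (F.s e * F.gap (trace hfin (ranE e)))) (fun _ _ => rfl) ?_).trans ?_)
      · intro e he
        rw [trace_ranE_eq_empty hfin he, gap_empty, mul_zero, zero_mul]
      · exact Finset.sum_congr rfl fun e _ => F.splitS_mul_star_add hfin e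
    · exact (inr_notMem_reg y hv).elim

theorem map_split (π : 𝔄 →⋆ₙₐ[ℂ] 𝔅) : (F.map π).split hfin = (F.split hfin).map π := by
  have hcore : ∀ A, (F.map π).core hfin A = π (F.core hfin A) := fun A => by
    rw [core, core, map_gap, map_sub]
    rfl
  refine eq_of_s_p (fun e => ?_) fun Z => ?_
  · rcases e with e | e
    · change π (F.s e) * (F.map π).core hfin (ranE e) = π (F.s e * F.core hfin (ranE e))
      rw [hcore, map_mul]
    · change π (F.s e.1) * (F.map π).gap (trace hfin (ranE e.1)) =
        π (F.s e.1 * F.gap (trace hfin (ranE e.1)))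
      rw [map_gap, map_mul]
  · change (F.map π).splitP hfin Z = π (F.splitP hfin Z)
    rw [splitP, splitP, hcore, map_gap, map_add]

/-! ### The two constructions are inverse to each other -/

theorem glue_split (hX : X ⊆ G.Reg) : (F.split hfin).glue hX = F := by
  refine eq_of_s_p (fun e => ?_) fun A => ?_
  · have h : (F.split hfin).sNew e = F.s e * F.gap (trace hfin (ranE e)) := by
      by_cases he : (G.ran e ∩ G.Y X).Nonempty
      · exact sNew_of_nonempty _ he
      · rw [sNew_of_not_nonempty _ he, trace_ranE_eq_empty hfin he, gap_empty, mul_zero]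
    rw [glue_s, h]
    change F.s e * F.core hfin (ranE e) + _ = _
    rw [← mul_add, core_add_gap, s_mul_p_ran]
  · change F.splitP hfin (inlE X A) + F.splitP hfin (primeE X A) = _
    rw [splitP_inlE, splitP_primeE, core_add_gap]

theorem split_glue (F : RelFamily (G.ext X) (G.ext X).Reg 𝔄) (hX : X ⊆ G.Reg) :
    (F.glue hX).split hfin = F := by
  refine eq_of_s_p (fun e => ?_) fun Z => ?_
  · rcases e with e | e
    · change (F.glue hX).s e * (F.glue hX).core hfin (ranE e) = F.sOld e
      rw [glue_core, glue_s, add_mul, sOld_mul_p_ran, sNew_mul_p_inlE, add_zero]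
    · change (F.glue hX).s e.1 * (F.glue hX).gap (trace hfin (ranE e.1)) = _
      rw [glue_gap_trace, glue_s, add_mul, sOld_mul_p_primeE, sNew_mul_p_ran, zero_add]
      exact F.sNew_of_nonempty e.2
  · obtain ⟨A, B, rfl⟩ := exists_eq_unionE hfin Z
    change (F.glue hX).splitP hfin (unionE X A B) = _
    rw [splitP_unionE, glue_core, glue_gap_trace]
    exact (F.p_union_of_disjoint rfl (disjoint_inlE_primeE A B)).symm

end Split

end RelFamily


/-! ### The homomorphisms of the theorem in terms of families -/

theorem isPhi_iff (hX : X ⊆ G.Reg) (φ : RelCStar G X →⋆ₙₐ[ℂ] CStar (G.ext X)) :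
    IsPhi φ ↔ (∀ e, φ (RelCStar.s G X e) = ((RelCStar.family (G.ext X) _).glue hX).s e) ∧
      ∀ A, φ (RelCStar.p G X A) = ((RelCStar.family (G.ext X) _).glue hX).p A := by
  constructor
  · refine fun h => ⟨fun e => ?_, h.map_p⟩
    rw [RelFamily.glue_s]
    by_cases he : (G.ran e ∩ G.Y X).Nonempty
    · rw [RelFamily.sNew_of_nonempty _ he]
      exact h.map_s_of_nonempty e he
    · rw [RelFamily.sNew_of_not_nonempty _ he, add_zero]
      exact h.map_s_of_empty e (Set.not_nonempty_iff_eq_empty.1 he)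
  · rintro ⟨hs, hp⟩
    refine ⟨hp, fun e he => ?_, fun e he => ?_⟩
    · rw [hs, RelFamily.glue_s,
        RelFamily.sNew_of_not_nonempty _ (Set.not_nonempty_iff_eq_empty.2 he), add_zero]
      rfl
    · rw [hs, RelFamily.glue_s, RelFamily.sNew_of_nonempty _ he]
      rfl

section Psi

variable (hfin : ∀ e, (G.ran e ∩ G.Y X).Finite)

theorem sumQ_eq_gap (B : G.E) : sumQ hfin B = (RelCStar.family G X).gap (trace hfin B) := by
  refine Finset.sum_bij
    (fun w _ => ⟨w.1, ((finite_inter_Y hfin B.2).mem_toFinset.1 w.2).2⟩) ?_ ?_ ?_ ?_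
  · exact fun w _ => (mem_trace hfin B _).2 ((finite_inter_Y hfin B.2).mem_toFinset.1 w.2).1
  · exact fun w _ z _ h => Subtype.ext (Subtype.mk.inj h)
  · exact fun y hy => ⟨⟨y.1, (finite_inter_Y hfin B.2).mem_toFinset.2
      ⟨(mem_trace hfin B y).1 hy, y.2⟩⟩, Finset.mem_attach _ _, rfl⟩
  · exact fun _ _ => rfl

theorem sumSS_eq_sum (A : G.E) : sumSS hfin A = ∑ y ∈ trace hfin A,
    ∑ e ∈ y.2.1.2.toFinset, RelCStar.s G X e * star (RelCStar.s G X e) := by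
  classical
  rw [← Finset.sum_biUnion]
  · refine Finset.sum_congr ?_ fun _ _ => rfl
    ext e
    rw [Set.Finite.mem_toFinset, Finset.mem_biUnion]
    constructor
    · exact fun h => ⟨⟨G.src e, h.2⟩, (mem_trace hfin A _).2 h.1,
        (Set.Finite.mem_toFinset _).2 rfl⟩
    · rintro ⟨y, hy, he⟩
      have h : G.src e = y.1 := y.2.1.2.mem_toFinset.1 he
      exact ⟨h ▸ (mem_trace hfin A y).1 hy, h ▸ y.2⟩
  · intro y _ z _ hyz
    refine Finset.disjoint_left.2 fun e hy hz => hyz (Subtype.ext ?_)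
    have h1 : G.src e = y.1 := y.2.1.2.mem_toFinset.1 hy
    have h2 : G.src e = z.1 := z.2.1.2.mem_toFinset.1 hz
    exact h1.symm.trans h2

theorem p_interYE (F : RelFamily G X 𝔄) (A : G.E) :
    F.p (interYE hfin A) = ∑ y ∈ trace hfin A, F.p (vertE y.1) := by
  refine F.p_image_finset Subtype.val Subtype.val_injective _ _ ?_
  ext v
  constructor
  · exact fun h => ⟨⟨v, h.2⟩, (mem_trace hfin A _).2 h.1, rfl⟩
  · rintro ⟨y, hy, rfl⟩
    exact ⟨(mem_trace hfin A y).1 hy, y.2⟩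

theorem p_interYE_sub_sumSS (A : G.E) : RelCStar.p G X (interYE hfin A) - sumSS hfin A =
    (RelCStar.family G X).gap (trace hfin A) := by
  rw [sumSS_eq_sum]
  refine (congrArg (· - _) (p_interYE hfin (RelCStar.family G X) A)).trans ?_
  exact (Finset.sum_sub_distrib _ _).symm

theorem p_sub_p_interYE_add_sumSS (A : G.E) :
    RelCStar.p G X A - RelCStar.p G X (interYE hfin A) + sumSS hfin A =
      (RelCStar.family G X).core hfin A := by
  rw [sub_add, p_interYE_sub_sumSS]
  rfl

/-- The formula for `ψ(P_Z)` does not depend on the choice of the decomposition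
`Z = A ∪ (B ∩ Y)'`. -/
theorem isPsi_iff (ψ : CStar (G.ext X) →⋆ₙₐ[ℂ] RelCStar G X) :
    IsPsi hfin ψ ↔
      (∀ e, ψ (RelCStar.s (G.ext X) _ e) = ((RelCStar.family G X).split hfin).s e) ∧
      ∀ Z, ψ (RelCStar.p (G.ext X) _ Z) = ((RelCStar.family G X).split hfin).p Z := by
  have key : ∀ A B : G.E, RelCStar.p G X A - RelCStar.p G X (interYE hfin A) + sumSS hfin A +
      sumQ hfin B = ((RelCStar.family G X).split hfin).p (unionE X A B) := fun A B => by
    rw [p_sub_p_interYE_add_sumSS, sumQ_eq_gap]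
    exact ((RelCStar.family G X).splitP_unionE hfin A B).symm
  constructor
  · refine fun h => ⟨?_, fun Z => ?_⟩
    · rintro (e | e)
      · refine (h.map_S e).trans ?_
        rw [p_sub_p_interYE_add_sumSS]
        rfl
      · refine (h.map_S' e.1 e.2).trans ?_
        rw [p_interYE_sub_sumSS]
        rfl
    · obtain ⟨A, B, rfl, hψ⟩ := h.map_P Z
      exact hψ.trans (key A B)
  · rintro ⟨hs, hp⟩
    refine ⟨fun Z => ?_, fun e => ?_, fun e he => ?_⟩
    · obtain ⟨A, B, rfl⟩ := exists_eq_unionE hfin Z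
      exact ⟨A, B, rfl, (hp _).trans (key A B).symm⟩
    · rw [p_sub_p_interYE_add_sumSS]
      exact hs (Sum.inl e)
    · rw [p_interYE_sub_sumSS]
      exact hs (Sum.inr ⟨e, he⟩)

end Psi

/-- A `*`-endomorphism of `C*(G, X)` that fixes the canonical generators is the identity. -/
theorem RelCStar.eq_id_of_map_family (π : RelCStar G X →⋆ₙₐ[ℂ] RelCStar G X)
    (h : (RelCStar.family G X).map π = RelCStar.family G X) :
    π = .id ℂ (RelCStar G X) :=
  (RelCStar.existsUnique_hom (RelCStar.family G X)).unique
    ⟨fun e => congrArg (fun F => F.s e) h, fun A => congrArg (fun F => F.p A) h⟩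
    ⟨fun _ => rfl, fun _ => rfl⟩

end Ultragraph

theorem mainTheorem1 (G : Ultragraph.{u}) (X : Set G.Vert) (hX : X ⊆ G.Reg)
    (hfin : ∀ e : G.Edge, (G.ran e ∩ G.Y X).Finite) :
    (∃! φ : G.RelCStar X →⋆ₙₐ[ℂ] (G.ext X).CStar, Ultragraph.IsPhi φ) ∧
    (∃! ψ : (G.ext X).CStar →⋆ₙₐ[ℂ] G.RelCStar X, Ultragraph.IsPsi hfin ψ) ∧
    ∀ (φ : G.RelCStar X →⋆ₙₐ[ℂ] (G.ext X).CStar) (ψ : (G.ext X).CStar →⋆ₙₐ[ℂ] G.RelCStar X),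
      Ultragraph.IsPhi φ → Ultragraph.IsPsi hfin ψ →
        ∃ Φ : G.RelCStar X ≃⋆ₐ[ℂ] (G.ext X).CStar,
          (∀ a, Φ a = φ a) ∧ ∀ b, Φ.symm b = ψ b := by
  refine ⟨?_, ?_, fun φ ψ hφ hψ => ?_⟩
  · simp only [Ultragraph.isPhi_iff hX]
    exact Ultragraph.RelCStar.existsUnique_hom _
  · simp only [Ultragraph.isPsi_iff hfin]
    exact Ultragraph.RelCStar.existsUnique_hom _
  · let F := Ultragraph.RelCStar.family G X
    let F' := Ultragraph.RelCStar.family (G.ext X) (G.ext X).Reg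
    have hF : F.map φ = F'.glue hX :=
      Ultragraph.RelFamily.eq_of_s_p ((Ultragraph.isPhi_iff hX φ).1 hφ).1
        ((Ultragraph.isPhi_iff hX φ).1 hφ).2
    have hF' : F'.map ψ = F.split hfin :=
      Ultragraph.RelFamily.eq_of_s_p ((Ultragraph.isPsi_iff hfin ψ).1 hψ).1
        ((Ultragraph.isPsi_iff hfin ψ).1 hψ).2
    have h1 : ψ.comp φ = .id ℂ _ := Ultragraph.RelCStar.eq_id_of_map_family _ <|
      calc (F.map φ).map ψ = (F'.map ψ).glue hX := by rw [hF, F'.map_glue]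
        _ = F := by rw [hF', F.glue_split]
    have h2 : φ.comp ψ = .id ℂ _ := Ultragraph.RelCStar.eq_id_of_map_family _ <|
      calc (F'.map ψ).map φ = (F.map φ).split hfin := by rw [hF', F.map_split]
        _ = F' := by rw [hF, Ultragraph.RelFamily.split_glue]
    exact ⟨StarAlgEquiv.ofNonUnitalStarAlgHom φ ψ h1 h2, fun _ => rfl, fun _ => rfl⟩
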